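/- Let $(X,\mathsf d)$ be a compact metric space and $\mathfrak m$ a Borel probability measure on $X$. For a Lipschitz $g:X\to\mathbb R$ let $|Dg|(x)=\limsup_{y\to x}\frac{|g(y)-g(x)|}{\mathsf d(y,x)}$ (equal to $0$ at isolated points). A function $G\in L^2(X,\mathfrak m)$ is a relaxed slope of $f\in L^2(X,\mathfrak m)$ if there are Lipschitz functions $g_n\to f$ in $L^2(X,\mathfrak m)$ such that $|Dg_n|$ converges weakly in $L^2(X,\mathfrak m)$ to some $\tilde G\le G$ $\mathfrak m$-a.e.; the relaxed slope of $f$ of minimal $L^2$ norm is denoted by $|Df|_*$. The Cheeger energy is $\mathrm{Ch}(f)=\frac12\int_X|Df|_*^2\,d\mathfrak m$, set to $+\infty$ if $f$ has no relaxed slope. The $L^2$-gradient flow of $\mathrm{Ch}$ starting from $f_0\in L^2(X,\mathfrak m)$ is the curve $(f_t)_{t\ge0}$ in $L^2(X,\mathfrak m)$, locally Lipschitz on $(0,\infty)$, with $f_t\to f_0$ in $L^2(X,\mathfrak m)$ as $t\downarrow0$ and $\frac{d}{dt}f_t\in-\partial\mathrm{Ch}(f_t)$ for a.e. $t>0$,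 where $\partial\mathrm{Ch}$ is the subdifferential of convex analysis. $W_2$ denotes the quadratic Wasserstein distance on Borel probability measures on $X$. **Kuwada's lemma.** Let $f_0\in L^2(X,\mathfrak m)$ and let $(f_t)$ be the $L^2$-gradient flow of $\mathrm{Ch}$ starting from $f_0$. Assume that $c\le f_0\le C$ $\mathfrak m$-a.e. for some $0<c\le C<\infty$, and that $\int_X f_0\,d\mathfrak m=1$. Then, for every $t\ge0$, $f_t>0$ $\mathfrak m$-a.e. and $\mu_t:=f_t\mathfrak m$ is a probability measure; the curve $t\mapsto\mu_t$ is absolutely continuous with respect to $W_2$ on every bounded interval $[0,T]$, that is, for every $T>0$ there is $g\in L^1(0,T)$ with $W_2(\mu_s,\mu_t)\le\int_t^s g(r)\,dr$ for all $0\le t<s\le T$; and for a.e. $t\in(0,\infty)$ the metric speed $|\dot\mu_t|=\lim_{s\to t}\frac{W_2(\mu_s,\mu_t)}{|s-t|}$ exists, $f_t$ has a minimal relaxed slope, $|Df_t|_*^2/f_t$ is $\mathfrak m$-integrable, and $$|\dot\mu_t|^2\le\int_X\frac{|Df_t|_*^2}{f_t}\,d\mathfrak m .$$ -/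

import Mathlib

open MeasureTheory Filter Set
open scoped Topology ENNReal

noncomputable section

namespace MetricHeat

/-! ### Curves in a space with a distance function -/

/-- A curve `γ` is absolutely continuous on the interval `J` with respect to the distance `d`:
`d (γ s) (γ t) ≤ ∫ r in t..s, g r` for all `t < s` in `J`, for some `g ∈ L¹(J)`. -/
def AbsolutelyContinuousCurve {Y : Type*} (d : Y → Y → ℝ) (J : Set ℝ) (γ : ℝ → Y) : Prop :=
  ∃ g : ℝ → ℝ, IntegrableOn g J ∧
    ∀ t ∈ J, ∀ s ∈ J, t < s → d (γ s) (γ t) ≤ ∫ r in t..s, g r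

/-- The metric speed of `γ` at time `t` exists and equals `v`. -/
def HasMetricSpeedAt {Y : Type*} (d : Y → Y → ℝ) (γ : ℝ → Y) (t v : ℝ) : Prop :=
  Tendsto (fun s => d (γ s) (γ t) / |s - t|) (𝓝[≠] t) (𝓝 v)

/-! ### Gradient flows of functionals on a Hilbert space -/

section Hilbert

variable {H : Type*} [NormedAddCommGroup H] [InnerProductSpace ℝ H]

/-- The subdifferential of `E` at `g` in the sense of convex analysis;
it is empty unless `E g < ∞`. -/
def subdifferential (E : H → EReal) (g : H) : Set H :=
  {ξ | E g ≠ ⊤ ∧ ∀ h : H, E g + ((inner ℝ ξ (h - g) : ℝ) : EReal) ≤ E h}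

/-- The curve `u` (considered for times `t ≥ 0` only) is a gradient flow of `E`
starting from `u₀`. -/
structure IsGradientFlow (E : H → EReal) (u₀ : H) (u : ℝ → H) : Prop where
  initial : u 0 = u₀
  tendsto_initial : Tendsto u (𝓝[>] 0) (𝓝 u₀)
  locallyLipschitz : LocallyLipschitzOn (Ioi 0) u
  deriv_mem : ∀ᵐ t ∂(volume.restrict (Ioi (0 : ℝ))),
    ∃ u' : H, HasDerivAt u u' t ∧ -u' ∈ subdifferential E (u t)

end Hilbert

/-! ### Slopes, relaxed slopes and the Cheeger energy -/

section Slopes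

variable {X : Type*} [MetricSpace X]

/-- The slope (local Lipschitz constant) of `f` at `x`; it is `0` at isolated points. -/
def localSlope (f : X → ℝ) (x : X) : ℝ≥0∞ :=
  limsup (fun y => edist (f y) (f x) / edist y x) (𝓝[≠] x)

variable [MeasurableSpace X]

/-- `G` is a relaxed slope of `f`: there are Lipschitz functions `fn n` converging to `f` in `L²`
whose slopes converge weakly in `L²` to some `G' ≤ G`. -/
def IsRelaxedSlope (m : Measure X) (f G : Lp ℝ 2 m) : Prop :=
  ∃ (G' : Lp ℝ 2 m) (fn : ℕ → X → ℝ),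
    (∀ n, ∃ K, LipschitzWith K (fn n)) ∧
    Tendsto (fun n => eLpNorm (fun x => fn n x - f x) 2 m) atTop (𝓝 0) ∧
    (∀ h : Lp ℝ 2 m, Tendsto (fun n => ∫ x, h x * (localSlope (fn n) x).toReal ∂m) atTop
      (𝓝 (∫ x, h x * G' x ∂m))) ∧
    ∀ᵐ x ∂m, G' x ≤ G x

/-- `G` is a relaxed slope of `f` of minimal `L²` norm. -/
def IsMinimalRelaxedSlope (m : Measure X) (f G : Lp ℝ 2 m) : Prop :=
  IsRelaxedSlope m f G ∧ ∀ G₁ : Lp ℝ 2 m, IsRelaxedSlope m f G₁ → ‖G‖ ≤ ‖G₁‖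

open Classical in
/-- The minimal relaxed slope of `f` (with the value `0` if there is none). -/
def minimalRelaxedSlope (m : Measure X) (f : Lp ℝ 2 m) : Lp ℝ 2 m :=
  if h : ∃ G, IsMinimalRelaxedSlope m f G then h.choose else 0

open Classical in
/-- The Cheeger energy: half the integral of the squared minimal relaxed slope,
and `+∞` if there is no relaxed slope. -/
def cheegerEnergy (m : Measure X) (f : Lp ℝ 2 m) : EReal :=
  if ∃ G, IsRelaxedSlope m f G then
    ((1 / 2 * ∫ x, (minimalRelaxedSlope m f x) ^ 2 ∂m : ℝ) : EReal)
  else ⊤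

/-! ### The Wasserstein distance -/

/-- `γ` is a coupling of `μ` and `ν`. -/
def IsCoupling (μ ν : Measure X) (γ : Measure (X × X)) : Prop :=
  IsProbabilityMeasure γ ∧ γ.map Prod.fst = μ ∧ γ.map Prod.snd = ν

/-- The Wasserstein distance `W₂`, to be used for Borel probability measures on a compact metric
space (where the infimum is a minimum). -/
def W2 (μ ν : Measure X) : ℝ :=
  Real.sqrt (sInf {r : ℝ | ∃ γ : Measure (X × X), IsCoupling μ ν γ ∧
    r = ∫ p, dist p.1 p.2 ^ 2 ∂γ})

/-- The measure `f m` with density `f` with respect to `m`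
(for a density `f` that is nonnegative almost everywhere). -/
def densityMeasure (m : Measure X) (f : Lp ℝ 2 m) : Measure X :=
  m.withDensity (fun x => ENNReal.ofReal (f x))

end Slopes

end MetricHeat

end

/-!
The estimate behind Kuwada's lemma is, for `0 ≤ t < s`,
`W₂(μ_t, μ_s)² ≤ (s - t) ∫_t^s A(r) dr`, where `A(r) = ∫ |Df_r|_*² / f_r dm`
(`MetricHeat.W2_sq_flow_le`). The arithmetic-geometric mean inequality turns it into absolute
continuity with the `L¹` bound `(1 + A) / 2`, and dividing by `(s - t)²` it bounds the metric speed
at the Lebesgue points of `A`.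

By Kantorovich duality (`MetricHeat.exists_coupling_integral_le`: Hahn-Banach and
Riesz-Markov-Kakutani) it is enough to bound `∫ Q₁χ f_s dm - ∫ χ f_t dm` for continuous `χ`, where
`Q` is the Hopf-Lax semigroup. Put `h = s - t`. The derivative of `τ ↦ ∫ Q_{(τ - t)/h} χ f_τ dm` has
two contributions (`MetricHeat.deriv_inner_hopfLax_le`). The Hamilton-Jacobi inequality
`∂_r Q_r χ ≤ -|DQ_r χ|² / 2`, valid at every point for the right derivative, gives
`-(1 / 2h) ∫ |DQχ|² f_τ dm`. The gradient flow equation gives at most `∫ |DQχ| |Df_τ|_* dm`, since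
a subgradient `ξ` of the Cheeger energy at `f` satisfies `∫ ξ g dm ≤ ∫ |Dg| |Df|_* dm` for
Lipschitz `g` (`MetricHeat.inner_le_inner_localSlope`). Young's inequality bounds the sum by
`(h / 2) A(τ)`. The evolution starts at a time `a > t` and `a ↓ t` afterwards: then only
`Q_r χ ≤ χ` is needed near `r = 0`, and continuity of the flow at `t`, which also covers `t = 0`.

Relaxed slopes are treated as the closure of the convex set of pairs of a Lipschitz function and a
bound for its slope (`MetricHeat.isRelaxedSlope_iff`). This makes sums, truncations and the
existence of minimal elements matters of Hilbert space geometry. Truncation gives the lower bound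
`f_t ≥ c`, translation by constants the conservation of mass. The parallelogram law bounds the
distance of the minimal relaxed slopes at two times with bounded subgradients
(`MetricHeat.norm_minimalRelaxedSlope_sub_sq_le`). Hence `A` is continuous on a set of times of
full measure, so it is measurable; it is integrable up to time `0` by the energy dissipation
`|Df_t|_*² ≤ -d/dt ‖f_t‖²` in `L²`.

The existence of the metric speed uses the triangle inequality for `W₂`, which also follows from
duality, with a Hopf-Lax function as intermediate potential (`MetricHeat.W2_triangle`), and the
representation of the speed as a supremum of derivatives of distance functions
(`MetricHeat.ae_exists_metricSpeed_of_lipschitz`).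
-/

set_option linter.unusedSectionVars false

namespace MetricHeat

/-! ### Lipschitz functions of one variable and the metric speed -/

/-- A differential inequality for a Lipschitz function, needed only at the points of
differentiability, can be integrated. -/
theorem sub_le_integral_of_ae_deriv_le {φ B : ℝ → ℝ} {a b : ℝ} {K : NNReal} (hab : a ≤ b)
    (hφ : LipschitzOnWith K φ (Icc a b)) (hB : IntervalIntegrable B volume a b)
    (h : ∀ᵐ t, t ∈ Ioo a b → ∀ φ' : ℝ, HasDerivAt φ φ' t → φ' ≤ B t) :
    φ b - φ a ≤ ∫ t in a..b, B t := by
  have hac : AbsolutelyContinuousOnInterval φ a b :=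
    LipschitzOnWith.absolutelyContinuousOnInterval (K := K) (by rwa [uIcc_of_le hab])
  rw [← hac.integral_deriv_eq_sub]
  refine intervalIntegral.integral_mono_ae_restrict hab hac.intervalIntegrable_deriv hB ?_
  have hd := hac.ae_differentiableAt
  rw [← Measure.restrict_congr_set Ioo_ae_eq_Icc]
  refine (ae_restrict_iff' measurableSet_Ioo).2 ?_
  filter_upwards [h, hd] with t h1 h2 ht
  exact h1 ht _ (h2 (by rw [uIcc_of_le hab]; exact Ioo_subset_Icc_self ht)).hasDerivAt

/-- The metric derivative of a Lipschitz curve exists almost everywhere. The speed at `t` is the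
supremum over rational times `q` of the derivative of the distance to the point at time `q`. -/
theorem ae_exists_metricSpeed_of_lipschitz {W : ℝ → ℝ → ℝ} {a b K : ℝ} (hK : 0 ≤ K)
    (hsymm : ∀ s ∈ Icc a b, ∀ t ∈ Icc a b, W s t = W t s)
    (htri : ∀ r ∈ Icc a b, ∀ s ∈ Icc a b, ∀ t ∈ Icc a b, W r t ≤ W r s + W s t)
    (hlip : ∀ s ∈ Icc a b, ∀ t ∈ Icc a b, W s t ≤ K * |s - t|) :
    ∀ᵐ t, t ∈ Ioo a b → ∃ v : ℝ, Tendsto (fun s => W s t / |s - t|) (𝓝[≠] t) (𝓝 v) := by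
  let Q := {q : ℚ // (q : ℝ) ∈ Ioo a b}
  let m : ℝ → ℝ := fun t => ⨆ q : Q, |deriv (W (q : ℚ)) t|
  have hQ : ∀ q : Q, ((q : ℚ) : ℝ) ∈ Icc a b := fun q => Ioo_subset_Icc_self q.2
  have habs : ∀ r ∈ Icc a b, ∀ s ∈ Icc a b, ∀ t ∈ Icc a b, |W r s - W r t| ≤ W s t := by
    intro r hr s hs t ht
    have h1 := htri r hr t ht s hs
    have h2 := htri r hr s hs t ht
    have h3 := hsymm s hs t ht
    rw [abs_le]; constructor <;> linarith
  have hLip : ∀ q : Q, LipschitzOnWith K.toNNReal (W (q : ℚ)) (Icc a b) := by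
    intro q
    refine LipschitzOnWith.of_dist_le_mul fun s hs t ht => ?_
    rw [Real.coe_toNNReal K hK, Real.dist_eq, Real.dist_eq]
    exact (habs _ (hQ q) s hs t ht).trans (hlip s hs t ht)
  have hderiv : ∀ t ∈ Ioo a b, ∀ q : Q, |deriv (W (q : ℚ)) t| ≤ K := by
    intro t ht q
    have := norm_deriv_le_of_lipschitzOn (Icc_mem_nhds ht.1 ht.2) (hLip q)
    rwa [Real.coe_toNNReal K hK, Real.norm_eq_abs] at this
  have hbdd : ∀ t ∈ Ioo a b, BddAbove (range fun q : Q => |deriv (W (q : ℚ)) t|) := by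
    rintro t ht
    exact ⟨K, by rintro _ ⟨q, rfl⟩; exact hderiv t ht q⟩
  have hm_meas : Measurable m :=
    Measurable.iSup fun q => continuous_abs.measurable.comp (measurable_deriv (W (q : ℚ)))
  have hm_nonneg : ∀ t, 0 ≤ m t := fun t => Real.iSup_nonneg fun q => abs_nonneg _
  have hm_le : ∀ t ∈ Ioo a b, m t ≤ K := by
    intro t ht
    exact Real.iSup_le (fun q => hderiv t ht q) hK
  have hm_int : IntegrableOn m (Ioo a b) := by
    refine Measure.integrableOn_of_bounded (M := K) (by simp)
      hm_meas.aestronglyMeasurable ?_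
    refine (ae_restrict_iff' measurableSet_Ioo).2 (ae_of_all _ fun t ht => ?_)
    rw [Real.norm_eq_abs, abs_of_nonneg (hm_nonneg t)]
    exact hm_le t ht
  -- the distance is bounded by the integral of the candidate speed
  have hupper : ∀ t ∈ Ioo a b, ∀ s ∈ Ioo a b, t ≤ s → W s t ≤ ∫ r in t..s, m r := by
    intro t ht s hs hts
    have hsub : Icc t s ⊆ Ioo a b := fun x hx => ⟨ht.1.trans_le hx.1, hx.2.trans_lt hs.2⟩
    have hint : IntervalIntegrable m volume t s :=
      (intervalIntegrable_iff_integrableOn_Icc_of_le hts).2 (hm_int.mono_set hsub)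
    have key : ∀ q : Q, W s t ≤ (∫ r in t..s, m r) + 2 * (K * |(q : ℚ) - t|) := by
      intro q
      have h1 := sub_le_integral_of_ae_deriv_le hts
        ((hLip q).mono (hsub.trans Ioo_subset_Icc_self)) hint (ae_of_all _ fun r hr φ' hφ' => by
          rw [← hφ'.deriv]
          exact (le_abs_self _).trans
            (le_ciSup (hbdd r (hsub (Ioo_subset_Icc_self hr))) q))
      have h2 := htri s (Ioo_subset_Icc_self hs) _ (hQ q) t (Ioo_subset_Icc_self ht)
      have h3 := hsymm s (Ioo_subset_Icc_self hs) _ (hQ q)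
      have h4 := hlip _ (hQ q) t (Ioo_subset_Icc_self ht)
      linarith
    refine le_of_forall_pos_le_add fun ε hε => ?_
    have hpos : 0 < ε / (2 * (K + 1)) := by positivity
    obtain ⟨q, hq1, hq2⟩ := exists_rat_btwn (lt_min ht.2 (lt_add_of_pos_right t hpos))
    have hqm : ((q : ℚ) : ℝ) ∈ Ioo a b := ⟨ht.1.trans hq1, hq2.trans_le (min_le_left _ _)⟩
    refine (key ⟨q, hqm⟩).trans ?_
    have h5 : |(q : ℝ) - t| ≤ ε / (2 * (K + 1)) := by
      rw [abs_of_pos (sub_pos.2 hq1)]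
      linarith [hq2.trans_le (min_le_right _ _)]
    have h6 : K * |(q : ℝ) - t| ≤ (K + 1) * (ε / (2 * (K + 1))) :=
      mul_le_mul (by linarith) h5 (abs_nonneg _) (by linarith)
    have h7 : (K + 1) * (ε / (2 * (K + 1))) = ε / 2 := by field_simp
    simp only
    linarith
  have hdiff : ∀ᵐ t, t ∈ Ioo a b → ∀ q : Q, DifferentiableAt ℝ (W (q : ℚ)) t := by
    rcases lt_or_ge b a with hba | hab
    · filter_upwards with t ht
      exact absurd (ht.1.trans ht.2) hba.not_gt
    have : ∀ q : Q, ∀ᵐ t, t ∈ uIcc a b → DifferentiableAt ℝ (W (q : ℚ)) t := fun q =>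
      (LipschitzOnWith.absolutelyContinuousOnInterval (K := K.toNNReal)
        (by rw [uIcc_of_le hab]; exact hLip q)).ae_differentiableAt
    filter_upwards [ae_all_iff.2 this] with t ht hmem q
    exact ht q (by rw [uIcc_of_le hab]; exact Ioo_subset_Icc_self hmem)
  have hleb : ∀ᵐ t, t ∈ Ioo a b →
      HasDerivAt (fun x => ∫ r in ((a + b) / 2)..x, m r) (m t) t := by
    rcases lt_or_ge b a with hba | hab
    · filter_upwards with t ht
      exact absurd (ht.1.trans ht.2) hba.not_gt
    have hint : IntervalIntegrable m volume a b :=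
      (intervalIntegrable_iff_integrableOn_Ioo_of_le hab).2 hm_int
    filter_upwards [hint.ae_hasDerivAt_integral] with t ht hmem
    refine ht (by rw [uIcc_of_le hab]; exact Ioo_subset_Icc_self hmem) _ ?_
    rw [uIcc_of_le hab]; constructor <;> linarith
  filter_upwards [hdiff, hleb] with t h1 h2 ht
  specialize h1 ht
  specialize h2 ht
  refine ⟨m t, ?_⟩
  have hnear : ∀ᶠ s in 𝓝[≠] t, s ∈ Ioo a b ∧ s ≠ t :=
    (eventually_nhdsWithin_of_eventually_nhds (Ioo_mem_nhds ht.1 ht.2)).and self_mem_nhdsWithin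
  have hQne : Nonempty Q := by
    obtain ⟨q, hq⟩ := exists_rat_btwn (ht.1.trans ht.2)
    exact ⟨⟨q, hq⟩⟩
  have hc : (a + b) / 2 ∈ Ioo a b := by
    have := ht.1.trans ht.2
    constructor <;> linarith
  refine tendsto_order.2 ⟨fun l hl => ?_, fun u hu => ?_⟩
  · obtain ⟨q, hq⟩ := exists_lt_of_lt_ciSup hl
    have h3 := ((h1 q).hasDerivAt.tendsto_slope).abs
    filter_upwards [h3.eventually (lt_mem_nhds hq), hnear] with s hs hst
    refine hs.trans_le ?_
    rw [slope_def_field, abs_div]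
    exact div_le_div_of_nonneg_right (habs _ (hQ q) s (Ioo_subset_Icc_self hst.1) t
      (Ioo_subset_Icc_self ht)) (abs_nonneg _)
  · have h3 := h2.tendsto_slope
    have hii : ∀ s ∈ Ioo a b, ∀ s' ∈ Ioo a b, IntervalIntegrable m volume s s' := by
      intro s hs s' hs'
      refine (hm_int.mono_set ?_).intervalIntegrable
      exact (ordConnected_Ioo).uIcc_subset hs hs'
    filter_upwards [h3.eventually (gt_mem_nhds hu), hnear] with s hs hst
    refine lt_of_le_of_lt ?_ hs
    rw [slope_def_field, intervalIntegral.integral_interval_sub_left (hii _ hc _ hst.1)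
      (hii _ hc _ ht)]
    rcases lt_or_gt_of_ne hst.2 with hlt | hgt
    · rw [abs_of_neg (sub_neg.2 hlt), intervalIntegral.integral_symm, ← neg_sub t s, neg_neg,
        neg_div_neg_eq, hsymm s (Ioo_subset_Icc_self hst.1) t (Ioo_subset_Icc_self ht)]
      exact div_le_div_of_nonneg_right (hupper s hst.1 t ht hlt.le) (sub_nonneg.2 hlt.le)
    · rw [abs_of_pos (sub_pos.2 hgt)]
      exact div_le_div_of_nonneg_right (hupper t ht s hst.1 hgt.le) (sub_nonneg.2 hgt.le)

/-- The metric derivative of a curve on `(0, ∞)`, parametrized by its distance function `W`, exists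
almost everywhere if the curve is Lipschitz on compact subintervals. -/
theorem ae_exists_metricSpeed {W : ℝ → ℝ → ℝ}
    (hsymm : ∀ s, 0 < s → ∀ t, 0 < t → W s t = W t s)
    (htri : ∀ r, 0 < r → ∀ s, 0 < s → ∀ t, 0 < t → W r t ≤ W r s + W s t)
    (hlip : ∀ a b, 0 < a → a ≤ b → ∃ K, 0 ≤ K ∧
      ∀ s ∈ Icc a b, ∀ t ∈ Icc a b, W s t ≤ K * |s - t|) :
    ∀ᵐ t ∂(volume.restrict (Ioi (0 : ℝ))), ∃ v : ℝ,
      Tendsto (fun s => W s t / |s - t|) (𝓝[≠] t) (𝓝 v) := by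
  have key : ∀ n : ℕ, ∀ᵐ t : ℝ, t ∈ Ioo (1 / ((n : ℝ) + 1)) (n + 1) → ∃ v : ℝ,
      Tendsto (fun s => W s t / |s - t|) (𝓝[≠] t) (𝓝 v) := by
    intro n
    have h0 : 0 < 1 / ((n : ℝ) + 1) := by positivity
    have h1 : 1 / ((n : ℝ) + 1) ≤ n + 1 := by
      rw [div_le_iff₀ (by positivity)]
      nlinarith [Nat.cast_nonneg (α := ℝ) n]
    obtain ⟨K, hK, hW⟩ := hlip _ _ h0 h1
    exact ae_exists_metricSpeed_of_lipschitz hK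
      (fun s hs t ht => hsymm s (h0.trans_le hs.1) t (h0.trans_le ht.1))
      (fun r hr s hs t ht => htri r (h0.trans_le hr.1) s (h0.trans_le hs.1) t (h0.trans_le ht.1))
      hW
  refine (ae_restrict_iff' measurableSet_Ioi).2 ?_
  filter_upwards [ae_all_iff.2 key] with t ht ht0
  obtain ⟨n, hn⟩ := exists_nat_gt (max t (1 / t))
  have hn1 : t < n := (le_max_left _ _).trans_lt hn
  have hn2 : 1 / t < n := (le_max_right _ _).trans_lt hn
  refine ht n ⟨?_, by linarith⟩
  rw [div_lt_iff₀ (by positivity)]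
  rw [div_lt_iff₀ ht0] at hn2
  have : (0 : ℝ) < t := ht0
  nlinarith

/-! ### Gradient flows in a Hilbert space -/

section Hilbert

variable {H : Type*} [NormedAddCommGroup H]

theorem exists_lipschitzOnWith_Icc {u : ℝ → H} (hu : LocallyLipschitzOn (Ioi 0) u) {a b : ℝ}
    (ha : 0 < a) : ∃ K, LipschitzOnWith K u (Icc a b) :=
  (hu.mono fun _ hx => ha.trans_le hx.1).exists_lipschitzOnWith_of_compact isCompact_Icc

variable [InnerProductSpace ℝ H] {E : H → EReal} {u₀ : H} {u : ℝ → H}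

/-- The inner product of two Lipschitz curves is Lipschitz on compact intervals. -/
theorem exists_lipschitzOnWith_inner {u v : ℝ → H} {a b : ℝ} {K L : NNReal}
    (hu : LipschitzOnWith K u (Icc a b)) (hv : LipschitzOnWith L v (Icc a b)) :
    ∃ C, LipschitzOnWith C (fun t => inner ℝ (u t) (v t)) (Icc a b) := by
  obtain ⟨M, hM⟩ := isCompact_Icc.exists_bound_of_continuousOn hu.continuousOn
  obtain ⟨N, hN⟩ := isCompact_Icc.exists_bound_of_continuousOn hv.continuousOn
  refine ⟨K * N.toNNReal + M.toNNReal * L, LipschitzOnWith.of_dist_le_mul fun s hs t ht => ?_⟩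
  have e : inner ℝ (u s) (v s) - inner ℝ (u t) (v t) =
      inner ℝ (u s - u t) (v s) + inner ℝ (u t) (v s - v t) := by
    rw [inner_sub_left, inner_sub_right]; ring
  have h1 : |inner ℝ (u s - u t) (v s)| ≤ K * dist s t * N.toNNReal := by
    refine (abs_real_inner_le_norm _ _).trans (mul_le_mul ?_ ((hN s hs).trans
      (Real.le_coe_toNNReal N)) (norm_nonneg _) (by positivity))
    rw [← dist_eq_norm]; exact hu.dist_le_mul s hs t ht
  have h2 : |inner ℝ (u t) (v s - v t)| ≤ M.toNNReal * (L * dist s t) := by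
    refine (abs_real_inner_le_norm _ _).trans (mul_le_mul ((hM t ht).trans
      (Real.le_coe_toNNReal M)) ?_ (norm_nonneg _) (by positivity))
    rw [← dist_eq_norm]; exact hv.dist_le_mul s hs t ht
  rw [Real.dist_eq, e]
  refine (abs_add_le _ _).trans ((add_le_add h1 h2).trans_eq ?_)
  push_cast; ring

theorem IsGradientFlow.continuousOn (h : IsGradientFlow E u₀ u) : ContinuousOn u (Ici 0) := by
  intro t ht
  rcases eq_or_lt_of_le (show (0 : ℝ) ≤ t from ht) with rfl | ht
  · rw [← Ioi_insert, continuousWithinAt_insert_self, ContinuousWithinAt, h.initial]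
    exact h.tendsto_initial
  · exact ((h.locallyLipschitz.continuousOn t ht).continuousAt (Ioi_mem_nhds ht)).continuousWithinAt

/-- The velocity of a locally Lipschitz curve is locally bounded. -/
theorem norm_hasDerivAt_le {a b : ℝ} {K : NNReal} (hK : LipschitzOnWith K u (Icc a b)) {t : ℝ}
    (ht : t ∈ Ioo a b) {u' : H} (hu' : HasDerivAt u u' t) : ‖u'‖ ≤ K := by
  rw [← hu'.deriv]
  exact norm_deriv_le_of_lipschitzOn (Icc_mem_nhds ht.1 ht.2) hK

/-- If `P` is a nearest point map and the velocity of `u` points towards `P u`, then the distance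
of `u` from the range of `P` does not increase. -/
theorem norm_sub_nearest_le (hcont : ContinuousOn u (Ici 0)) (hlip : LocallyLipschitzOn (Ioi 0) u)
    {P : H → H} (hP : ∀ x y, ‖x - P x‖ ≤ ‖x - P y‖)
    (hd : ∀ᵐ t ∂(volume.restrict (Ioi (0 : ℝ))),
      ∃ u' : H, HasDerivAt u u' t ∧ inner ℝ u' (u t - P (u t)) ≤ 0)
    {t : ℝ} (ht : 0 ≤ t) : ‖u t - P (u t)‖ ≤ ‖u 0 - P (u 0)‖ := by
  have hL : ∀ x y, ‖x - P x‖ ≤ ‖x - y‖ + ‖y - P y‖ := fun x y =>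
    (hP x y).trans (by simpa using norm_add_le (x - y) (y - P y))
  have hL' : LipschitzWith 1 fun x => ‖x - P x‖ := by
    refine LipschitzWith.of_le_add fun x y => ?_
    rw [dist_eq_norm]; linarith [hL x y]
  have key : ∀ a, 0 < a → a ≤ t → ‖u t - P (u t)‖ ^ 2 ≤ ‖u a - P (u a)‖ ^ 2 := by
    intro a ha hat
    obtain ⟨K, hK⟩ := exists_lipschitzOnWith_Icc hlip (b := t) ha
    have hK' : LipschitzOnWith (1 * K) (fun s => ‖u s - P (u s)‖) (Icc a t) :=
      hL'.comp_lipschitzOnWith hK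
    obtain ⟨L, hsq⟩ := exists_lipschitzOnWith_inner hK' hK'
    simp only [real_inner_self_eq_norm_sq, norm_norm] at hsq
    have := sub_le_integral_of_ae_deriv_le (B := fun _ => 0) hat hsq (by simp) ?_
    · simpa using this
    filter_upwards [(ae_restrict_iff' measurableSet_Ioi).1 hd] with s hs hst φ' hφ'
    obtain ⟨u', hu', hin⟩ := hs (ha.trans hst.1)
    -- the squared distance lies below a differentiable function, with equality at `s`, so that
    -- the two derivatives at `s` agree
    have hq : HasDerivAt (fun r => ‖u r - P (u s)‖ ^ 2) (2 * inner ℝ (u s - P (u s)) u') s :=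
      (hu'.sub_const (P (u s))).norm_sq
    have hmin : IsLocalMin (fun r => ‖u r - P (u s)‖ ^ 2 - ‖u r - P (u r)‖ ^ 2) s := by
      refine Eventually.of_forall fun r => ?_
      simp only [sub_self, sub_nonneg]
      exact pow_le_pow_left₀ (norm_nonneg _) (hP _ _) 2
    have := hmin.hasDerivAt_eq_zero (hq.sub hφ')
    rw [real_inner_comm] at this
    linarith
  have hcont' : ContinuousOn (fun s => ‖u s - P (u s)‖) (Ici 0) :=
    hL'.continuous.comp_continuousOn hcont
  rcases eq_or_lt_of_le ht with rfl | ht'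
  · exact le_rfl
  refine ge_of_tendsto ((hcont' 0 self_mem_Ici).tendsto.mono_left
    (nhdsWithin_mono 0 Ioi_subset_Ici_self)) ?_
  filter_upwards [Ioo_mem_nhdsGT ht'] with a ha
  exact (pow_le_pow_iff_left₀ (norm_nonneg _) (norm_nonneg _) two_ne_zero).1 (key a ha.1 ha.2.le)

/-- A linear functional that annihilates the velocity is constant along the curve. -/
theorem inner_eq_of_ae_inner_deriv_eq_zero (hcont : ContinuousOn u (Ici 0))
    (hlip : LocallyLipschitzOn (Ioi 0) u) {w : H}
    (hd : ∀ᵐ t ∂(volume.restrict (Ioi (0 : ℝ))),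
      ∃ u' : H, HasDerivAt u u' t ∧ inner ℝ w u' = 0)
    {t : ℝ} (ht : 0 ≤ t) : inner ℝ w (u t) = inner ℝ w (u 0) := by
  have key : ∀ w : H, (∀ᵐ t ∂(volume.restrict (Ioi (0 : ℝ))),
      ∃ u' : H, HasDerivAt u u' t ∧ inner ℝ w u' = 0) →
      ∀ a, 0 < a → a ≤ t → inner ℝ w (u t) - inner ℝ w (u a) ≤ 0 := by
    intro w hd a ha hat
    obtain ⟨K, hK⟩ := exists_lipschitzOnWith_Icc hlip (b := t) ha
    have hK' := (innerSL ℝ w).lipschitz.comp_lipschitzOnWith hK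
    have := sub_le_integral_of_ae_deriv_le (B := fun _ => 0) hat hK' (by simp) ?_
    · simpa using this
    filter_upwards [(ae_restrict_iff' measurableSet_Ioi).1 hd] with s hs hst φ' hφ'
    obtain ⟨u', hu', hin⟩ := hs (ha.trans hst.1)
    have h1 : HasDerivAt (⇑(innerSL ℝ w) ∘ u) (innerSL ℝ w u') s :=
      (innerSL ℝ w).hasFDerivAt.comp_hasDerivAt s hu'
    rw [hφ'.unique h1, innerSL_apply_apply, hin]
  have hneg : ∀ᵐ t ∂(volume.restrict (Ioi (0 : ℝ))),
      ∃ u' : H, HasDerivAt u u' t ∧ inner ℝ (-w) u' = 0 := by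
    filter_upwards [hd] with s ⟨u', h1, h2⟩
    exact ⟨u', h1, by simp [h2]⟩
  have heq : ∀ a, 0 < a → a ≤ t → inner ℝ w (u t) = inner ℝ w (u a) := by
    intro a ha hat
    have h1 := key w hd a ha hat
    have h2 := key (-w) hneg a ha hat
    simp only [inner_neg_left] at h2
    linarith
  rcases eq_or_lt_of_le ht with rfl | ht'
  · rfl
  have hcont' : ContinuousOn (fun s => inner ℝ w (u s)) (Ici 0) :=
    (innerSL ℝ w).continuous.comp_continuousOn hcont
  refine tendsto_nhds_unique (tendsto_const_nhds.congr' ?_) ((hcont' 0 self_mem_Ici).tendsto.mono_left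
    (nhdsWithin_mono 0 Ioi_subset_Ici_self))
  filter_upwards [Ioo_mem_nhdsGT ht'] with a ha
  exact heq a ha.1 ha.2.le

end Hilbert

/-! ### Kantorovich duality on a compact metric space -/

section Kantorovich

variable {X : Type*} [MetricSpace X] [CompactSpace X] [MeasurableSpace X] [BorelSpace X]

theorem integrable_continuousMap {Y : Type*} [TopologicalSpace Y] [CompactSpace Y]
    [MeasurableSpace Y] [OpensMeasurableSpace Y] (μ : Measure Y) [IsFiniteMeasure μ]
    (φ : C(Y, ℝ)) : Integrable φ μ :=
  φ.continuous.integrable_of_hasCompactSupport (HasCompactSupport.of_compactSpace φ)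

theorem IsCoupling.integral_fst {μ ν : Measure X} {γ : Measure (X × X)} (h : IsCoupling μ ν γ)
    (φ : C(X, ℝ)) : ∫ p, φ p.1 ∂γ = ∫ x, φ x ∂μ := by
  rw [← h.2.1, integral_map measurable_fst.aemeasurable φ.continuous.aestronglyMeasurable]

theorem IsCoupling.integral_snd {μ ν : Measure X} {γ : Measure (X × X)} (h : IsCoupling μ ν γ)
    (φ : C(X, ℝ)) : ∫ p, φ p.2 ∂γ = ∫ x, φ x ∂ν := by
  rw [← h.2.2, integral_map measurable_snd.aemeasurable φ.continuous.aestronglyMeasurable]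

theorem isCoupling_prod (μ ν : Measure X) [IsProbabilityMeasure μ] [IsProbabilityMeasure ν] :
    IsCoupling μ ν (μ.prod ν) :=
  ⟨inferInstance, by simp, by simp⟩

/-- Weak duality. -/
theorem IsCoupling.integral_add_le {μ ν : Measure X} {γ : Measure (X × X)} (h : IsCoupling μ ν γ)
    {φ ψ : C(X, ℝ)} {c : C(X × X, ℝ)} (hc : ∀ x y, φ x + ψ y ≤ c (x, y)) :
    ∫ x, φ x ∂μ + ∫ x, ψ x ∂ν ≤ ∫ p, c p ∂γ := by
  have := h.1
  have h1 : Integrable (fun p : X × X => φ p.1) γ :=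
    integrable_continuousMap γ (φ.comp ⟨Prod.fst, continuous_fst⟩)
  have h2 : Integrable (fun p : X × X => ψ p.2) γ :=
    integrable_continuousMap γ (ψ.comp ⟨Prod.snd, continuous_snd⟩)
  rw [← h.integral_fst, ← h.integral_snd, ← integral_add h1 h2]
  exact integral_mono (h1.add h2) (integrable_continuousMap γ c) fun p => hc p.1 p.2

/-- The values `∫ φ dμ + ∫ ψ dν` for the pairs of potentials with `u ≤ φ ⊕ ψ`. Their infimum is a
sublinear function of `u`; at `u = -c` it is the opposite of the dual value for the cost `c`. -/
def dualValues (μ ν : Measure X) (u : C(X × X, ℝ)) : Set ℝ :=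
  {r | ∃ φ ψ : C(X, ℝ), (∀ x y, u (x, y) ≤ φ x + ψ y) ∧ r = ∫ x, φ x ∂μ + ∫ x, ψ x ∂ν}

variable (μ ν : Measure X) [IsProbabilityMeasure μ] [IsProbabilityMeasure ν]

theorem dualValues_nonempty (u : C(X × X, ℝ)) : (dualValues μ ν u).Nonempty :=
  ⟨_, .const X ‖u‖, 0, fun x y => by
    simpa using (le_abs_self _).trans (u.norm_coe_le_norm (x, y)), rfl⟩

theorem integral_le_of_mem_dualValues {u : C(X × X, ℝ)} {r : ℝ} (hr : r ∈ dualValues μ ν u) :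
    ∫ p, u p ∂(μ.prod ν) ≤ r := by
  obtain ⟨φ, ψ, h, rfl⟩ := hr
  have := (isCoupling_prod μ ν).integral_add_le (φ := -φ) (ψ := -ψ) (c := -u) (fun x y => by
    simp only [ContinuousMap.neg_apply]; linarith [h x y])
  simp only [ContinuousMap.neg_apply, integral_neg] at this
  linarith

theorem bddBelow_dualValues (u : C(X × X, ℝ)) : BddBelow (dualValues μ ν u) :=
  ⟨_, fun _ hr => integral_le_of_mem_dualValues μ ν hr⟩

theorem sInf_dualValues_add (u v : C(X × X, ℝ)) :
    sInf (dualValues μ ν (u + v)) ≤ sInf (dualValues μ ν u) + sInf (dualValues μ ν v) := by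
  rw [← csInf_add (dualValues_nonempty μ ν u) (bddBelow_dualValues μ ν u)
    (dualValues_nonempty μ ν v) (bddBelow_dualValues μ ν v)]
  refine csInf_le_csInf (bddBelow_dualValues μ ν _)
    ((dualValues_nonempty μ ν u).add (dualValues_nonempty μ ν v)) ?_
  rintro _ ⟨_, ⟨φ, ψ, h, rfl⟩, _, ⟨φ', ψ', h', rfl⟩, rfl⟩
  refine ⟨φ + φ', ψ + ψ', fun x y => ?_, ?_⟩
  · simp only [ContinuousMap.add_apply]; linarith [h x y, h' x y]
  · simp only [ContinuousMap.add_apply]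
    rw [integral_add (integrable_continuousMap μ φ) (integrable_continuousMap μ φ'),
      integral_add (integrable_continuousMap ν ψ) (integrable_continuousMap ν ψ')]
    ring

theorem sInf_dualValues_smul_le {a : ℝ} (ha : 0 < a) (u : C(X × X, ℝ)) :
    sInf (dualValues μ ν (a • u)) ≤ a * sInf (dualValues μ ν u) := by
  rw [← div_le_iff₀' ha]
  refine le_csInf (dualValues_nonempty μ ν u) ?_
  rintro _ ⟨φ, ψ, h, rfl⟩
  rw [div_le_iff₀' ha]
  refine csInf_le (bddBelow_dualValues μ ν _) ⟨a • φ, a • ψ, fun x y => ?_, ?_⟩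
  · simp only [ContinuousMap.smul_apply, smul_eq_mul]
    nlinarith [h x y]
  · simp only [ContinuousMap.smul_apply, smul_eq_mul, integral_const_mul]
    ring

theorem sInf_dualValues_smul {a : ℝ} (ha : 0 < a) (u : C(X × X, ℝ)) :
    sInf (dualValues μ ν (a • u)) = a * sInf (dualValues μ ν u) := by
  refine le_antisymm (sInf_dualValues_smul_le μ ν ha u) ?_
  have := sInf_dualValues_smul_le μ ν (inv_pos.2 ha) (a • u)
  rwa [inv_smul_smul₀ ha.ne', inv_mul_eq_div, le_div_iff₀' ha] at this

/-- Kantorovich duality, including the existence of an optimal coupling: a linear functional below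
the dual value, obtained from the Hahn-Banach theorem, is positive and has the right marginals;
it is a coupling by the Riesz-Markov-Kakutani theorem. -/
theorem exists_coupling_integral_le (c : C(X × X, ℝ)) {B : ℝ}
    (hB : ∀ φ ψ : C(X, ℝ), (∀ x y, φ x + ψ y ≤ c (x, y)) → ∫ x, φ x ∂μ + ∫ x, ψ x ∂ν ≤ B) :
    ∃ γ, IsCoupling μ ν γ ∧ ∫ p, c p ∂γ ≤ B := by
  rcases eq_or_ne c 0 with rfl | hc
  · exact ⟨_, isCoupling_prod μ ν, by simpa using hB 0 0 (by simp)⟩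
  set N : C(X × X, ℝ) → ℝ := fun u => sInf (dualValues μ ν u) with hN
  have N_add := sInf_dualValues_add μ ν
  have N_hom : ∀ a : ℝ, 0 < a → ∀ u, N (a • u) = a * N u := fun a ha u =>
    sInf_dualValues_smul μ ν ha u
  have N_zero : N 0 = 0 := by
    have := N_hom 2 two_pos 0
    rw [smul_zero] at this; linarith
  have N_le : ∀ (u : C(X × X, ℝ)) (φ ψ : C(X, ℝ)), (∀ x y, u (x, y) ≤ φ x + ψ y) →
      N u ≤ ∫ x, φ x ∂μ + ∫ x, ψ x ∂ν := fun u φ ψ h =>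
    csInf_le (bddBelow_dualValues μ ν u) ⟨φ, ψ, h, rfl⟩
  have hc' : -c ≠ 0 := neg_ne_zero.2 hc
  obtain ⟨L, hL, hLN⟩ := exists_extension_of_le_sublinear
    (LinearPMap.mkSpanSingleton (K := ℝ) (-c) (N (-c)) hc') N N_hom N_add (by
      rintro ⟨x, hx⟩
      obtain ⟨a, rfl⟩ := Submodule.mem_span_singleton.1 hx
      refine (LinearPMap.mkSpanSingleton'_apply (σ := RingHom.id ℝ) (-c) (N (-c)) _ a hx).trans_le ?_
      simp only [RingHom.id_apply, smul_eq_mul]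
      rcases lt_trichotomy a 0 with ha | rfl | ha
      · have h1 := N_hom (-a) (neg_pos.2 ha) (-c)
        have h2 := N_add (a • -c) (-a • -c)
        rw [← add_smul, add_neg_cancel, zero_smul] at h2
        change N 0 ≤ N _ + N _ at h2
        rw [N_zero, h1] at h2
        linarith
      · simp [N_zero]
      · exact (N_hom a ha _).ge)
  have hLc : L (-c) = N (-c) := by
    have := hL ⟨-c, Submodule.mem_span_singleton_self _⟩
    rw [this]
    exact LinearPMap.mkSpanSingleton_apply ℝ ℝ hc' (N (-c))
  -- positivity: `0` dominates `-u` when `u` is nonnegative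
  have hLpos : ∀ u : C(X × X, ℝ), (∀ p, 0 ≤ u p) → 0 ≤ L u := by
    intro u hu
    have h1 := (hLN (-u)).trans (N_le (-u) 0 0 (fun x y => by simpa using hu (x, y)))
    simp at h1
    exact h1
  let Λ : CompactlySupportedContinuousMap (X × X) ℝ →ₚ[ℝ] ℝ :=
  { toFun := fun g => L g
    map_add' := fun g g' => L.map_add (g : C(X × X, ℝ)) (g' : C(X × X, ℝ))
    map_smul' := fun a g => L.map_smul a (g : C(X × X, ℝ))
    monotone' := fun g g' hgg' => by
      have := hLpos ((g' : C(X × X, ℝ)) - (g : C(X × X, ℝ))) (fun p => sub_nonneg.2 (hgg' p))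
      rw [map_sub] at this
      exact sub_nonneg.1 this }
  set γ : Measure (X × X) := RealRMK.rieszMeasure Λ
  have hγfin : IsFiniteMeasure γ := by infer_instance
  have hγ : ∀ u : C(X × X, ℝ), ∫ p, u p ∂γ = L u := fun u =>
    RealRMK.integral_rieszMeasure Λ (CompactlySupportedContinuousMap.continuousMapEquiv u)
  have hfst : ∀ φ : C(X, ℝ), ∫ p, φ p.1 ∂γ = ∫ x, φ x ∂μ := by
    have h1 : ∀ φ : C(X, ℝ), ∫ p, φ p.1 ∂γ ≤ ∫ x, φ x ∂μ := fun φ => by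
      have := (hLN (φ.comp ⟨Prod.fst, continuous_fst⟩)).trans (N_le _ φ 0 (by simp))
      rw [← hγ] at this
      simpa using this
    intro φ
    have h2 := h1 (-φ)
    simp only [ContinuousMap.neg_apply, integral_neg] at h2
    linarith [h1 φ]
  have hsnd : ∀ φ : C(X, ℝ), ∫ p, φ p.2 ∂γ = ∫ x, φ x ∂ν := by
    have h1 : ∀ φ : C(X, ℝ), ∫ p, φ p.2 ∂γ ≤ ∫ x, φ x ∂ν := fun φ => by
      have := (hLN (φ.comp ⟨Prod.snd, continuous_snd⟩)).trans (N_le _ 0 φ (by simp))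
      rw [← hγ] at this
      simpa using this
    intro φ
    have h2 := h1 (-φ)
    simp only [ContinuousMap.neg_apply, integral_neg] at h2
    linarith [h1 φ]
  have hprob : IsProbabilityMeasure γ := by
    have := hfst 1
    simp only [ContinuousMap.one_apply, integral_const, smul_eq_mul, mul_one, probReal_univ] at this
    exact ⟨by rwa [measureReal_def, ENNReal.toReal_eq_one_iff] at this⟩
  refine ⟨γ, ⟨hprob, ?_, ?_⟩, ?_⟩
  · refine ext_of_forall_integral_eq_of_IsFiniteMeasure fun φ => ?_
    rw [integral_map measurable_fst.aemeasurable φ.continuous.aestronglyMeasurable]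
    exact hfst φ
  · refine ext_of_forall_integral_eq_of_IsFiniteMeasure fun φ => ?_
    rw [integral_map measurable_snd.aemeasurable φ.continuous.aestronglyMeasurable]
    exact hsnd φ
  · have h1 : -B ≤ N (-c) := by
      refine le_csInf (dualValues_nonempty μ ν _) ?_
      rintro _ ⟨φ, ψ, h, rfl⟩
      have := hB (-φ) (-ψ) (fun x y => by
        have := h x y
        simp only [ContinuousMap.neg_apply] at this ⊢; linarith)
      simp only [ContinuousMap.neg_apply, integral_neg] at this
      linarith
    rw [← hLc, map_neg, ← hγ] at h1
    linarith

/-! ### The Wasserstein distance -/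

theorem bddBelow_transportCosts (μ ν : Measure X) :
    BddBelow {r : ℝ | ∃ γ : Measure (X × X), IsCoupling μ ν γ ∧
      r = ∫ p, dist p.1 p.2 ^ 2 ∂γ} :=
  ⟨0, by rintro _ ⟨γ, -, rfl⟩; exact integral_nonneg fun p => sq_nonneg _⟩

theorem W2_nonneg (μ ν : Measure X) : 0 ≤ W2 μ ν := Real.sqrt_nonneg _

theorem W2_sq_eq (μ ν : Measure X) : W2 μ ν ^ 2 =
    sInf {r : ℝ | ∃ γ : Measure (X × X), IsCoupling μ ν γ ∧ r = ∫ p, dist p.1 p.2 ^ 2 ∂γ} :=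
  Real.sq_sqrt (Real.sInf_nonneg (by
    rintro _ ⟨γ, -, rfl⟩; exact integral_nonneg fun p => sq_nonneg _))

theorem IsCoupling.swap {μ ν : Measure X} {γ : Measure (X × X)} (h : IsCoupling μ ν γ) :
    IsCoupling ν μ (γ.map Prod.swap) := by
  have := h.1
  refine ⟨Measure.isProbabilityMeasure_map measurable_swap.aemeasurable, ?_, ?_⟩
  · rw [Measure.map_map measurable_fst measurable_swap]; exact h.2.2
  · rw [Measure.map_map measurable_snd measurable_swap]; exact h.2.1

/-- The multiple `k d²` of the squared distance, as a continuous map. -/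
def sqDist (X : Type*) [MetricSpace X] (k : ℝ) : C(X × X, ℝ) :=
  ⟨fun p => k * dist p.1 p.2 ^ 2, by fun_prop⟩

theorem W2_comm (μ ν : Measure X) : W2 μ ν = W2 ν μ := by
  have key : ∀ μ ν : Measure X, {r : ℝ | ∃ γ : Measure (X × X), IsCoupling μ ν γ ∧
      r = ∫ p, dist p.1 p.2 ^ 2 ∂γ} ⊆ {r : ℝ | ∃ γ : Measure (X × X), IsCoupling ν μ γ ∧
      r = ∫ p, dist p.1 p.2 ^ 2 ∂γ} := by
    rintro μ ν _ ⟨γ, hγ, rfl⟩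
    refine ⟨_, hγ.swap, ?_⟩
    rw [integral_map measurable_swap.aemeasurable
      (Continuous.aestronglyMeasurable (by fun_prop))]
    simp [dist_comm]
  rw [W2, W2, (key μ ν).antisymm (key ν μ)]


/-- Weak duality for the Wasserstein distance, with potentials for the cost `k d²`. -/
theorem integral_add_le_W2_sq {k : ℝ} (hk : 0 ≤ k) {φ ψ : C(X, ℝ)}
    (h : ∀ x y, φ x + ψ y ≤ k * dist x y ^ 2) :
    ∫ x, φ x ∂μ + ∫ x, ψ x ∂ν ≤ k * W2 μ ν ^ 2 := by
  rw [W2_sq_eq, ← smul_eq_mul k, ← Real.sInf_smul_of_nonneg hk]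
  refine le_csInf (Set.Nonempty.smul_set ⟨_, _, isCoupling_prod μ ν, rfl⟩) ?_
  rintro _ ⟨_, ⟨γ, hγ, rfl⟩, rfl⟩
  refine (hγ.integral_add_le (c := sqDist X k) h).trans_eq ?_
  exact integral_const_mul _ _

/-- Strong duality for the Wasserstein distance: an upper bound for the dual problem is an upper
bound for the distance. -/
theorem W2_sq_le {B : ℝ} (hB : ∀ φ ψ : C(X, ℝ), (∀ x y, φ x + ψ y ≤ 1 / 2 * dist x y ^ 2) →
    ∫ x, φ x ∂μ + ∫ x, ψ x ∂ν ≤ 1 / 2 * B) : W2 μ ν ^ 2 ≤ B := by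
  obtain ⟨γ, hγ, hle⟩ := exists_coupling_integral_le μ ν (sqDist X (1 / 2)) hB
  rw [W2_sq_eq]
  refine (csInf_le (bddBelow_transportCosts μ ν) ⟨γ, hγ, rfl⟩).trans ?_
  change ∫ p : X × X, 1 / 2 * dist p.1 p.2 ^ 2 ∂γ ≤ _ at hle
  rw [integral_const_mul] at hle
  linarith

theorem W2_self : W2 μ μ = 0 := by
  have := W2_sq_le μ μ (B := 0) fun φ ψ h => by
    rw [← integral_add (integrable_continuousMap μ φ) (integrable_continuousMap μ ψ), mul_zero]
    exact integral_nonpos fun x => by simpa using h x x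
  exact pow_eq_zero_iff two_ne_zero |>.1 (le_antisymm this (sq_nonneg _))

end Kantorovich

/-! ### The Hopf-Lax semigroup -/

section HopfLax

variable {X : Type*} [MetricSpace X] [CompactSpace X]

/-- The Hopf-Lax function `x ↦ inf_y (φ y + d(x, y)² / (2 t))`, to be used for `t > 0`. -/
noncomputable def hopfLax (φ : C(X, ℝ)) (t : ℝ) : C(X, ℝ) :=
  ⟨fun x => sInf ((fun y => φ y + dist x y ^ 2 / (2 * t)) '' univ),
    isCompact_univ.continuous_sInf (by fun_prop)⟩

theorem continuous_hopfLax_cost (φ : C(X, ℝ)) (t : ℝ) (x : X) :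
    Continuous fun y => φ y + dist x y ^ 2 / (2 * t) := by fun_prop

theorem hopfLax_le (φ : C(X, ℝ)) (t : ℝ) (x y : X) :
    hopfLax φ t x ≤ φ y + dist x y ^ 2 / (2 * t) :=
  csInf_le (isCompact_univ.bddBelow_image (continuous_hopfLax_cost φ t x).continuousOn)
    ⟨y, mem_univ y, rfl⟩

theorem hopfLax_le_self (φ : C(X, ℝ)) (t : ℝ) (x : X) : hopfLax φ t x ≤ φ x := by
  simpa using hopfLax_le φ t x x

variable [Nonempty X]

theorem exists_hopfLax_eq (φ : C(X, ℝ)) (t : ℝ) (x : X) :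
    ∃ y, hopfLax φ t x = φ y + dist x y ^ 2 / (2 * t) := by
  obtain ⟨y, -, hy⟩ := isCompact_univ.exists_sInf_image_eq univ_nonempty
    (continuous_hopfLax_cost φ t x).continuousOn
  exact ⟨y, hy⟩

/-- Comparison of the values at `z` and `x`, in terms of a minimizer for `x`. -/
theorem hopfLax_sub_le (φ : C(X, ℝ)) {t : ℝ} (ht : 0 < t) {x y : X} (z : X)
    (hy : hopfLax φ t x = φ y + dist x y ^ 2 / (2 * t)) :
    hopfLax φ t z - hopfLax φ t x ≤ dist z x * ((dist x y + dist z x) / t) := by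
  have h1 := hopfLax_le φ t z y
  have h2 : dist z y ≤ dist z x + dist x y := dist_triangle _ _ _
  have h3 : dist z y ^ 2 ≤ (dist z x + dist x y) ^ 2 := pow_le_pow_left₀ dist_nonneg h2 2
  have h4 : dist z y ^ 2 / (2 * t) ≤ (dist z x + dist x y) ^ 2 / (2 * t) :=
    div_le_div_of_nonneg_right h3 (by positivity)
  have h5 : dist z x * ((dist x y + dist z x) / t) -
      ((dist z x + dist x y) ^ 2 / (2 * t) - dist x y ^ 2 / (2 * t)) = dist z x ^ 2 / (2 * t) := by
    field_simp; ring
  have h6 : 0 ≤ dist z x ^ 2 / (2 * t) := by positivity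
  linarith

theorem lipschitzWith_hopfLax (φ : C(X, ℝ)) {t : ℝ} (ht : 0 < t) :
    ∃ K, LipschitzWith K (hopfLax φ t) := by
  refine ⟨Real.toNNReal (2 * Metric.diam (univ : Set X) / t), LipschitzWith.of_le_add_mul _
    fun z x => ?_⟩
  obtain ⟨y, hy⟩ := exists_hopfLax_eq φ t x
  have h1 := hopfLax_sub_le φ ht z hy
  have hd : ∀ x y : X, dist x y ≤ Metric.diam (univ : Set X) := fun x y =>
    Metric.dist_le_diam_of_mem isCompact_univ.isBounded (mem_univ x) (mem_univ y)
  rw [Real.coe_toNNReal _ (by have := Metric.diam_nonneg (s := (univ : Set X)); positivity)]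
  have h2 : dist z x * ((dist x y + dist z x) / t) ≤
      dist z x * (2 * Metric.diam (univ : Set X) / t) := by
    gcongr; linarith [hd x y, hd z x]
  linarith

/-- Lipschitz dependence on time, away from time `0`. -/
theorem norm_hopfLax_sub_le (φ : C(X, ℝ)) {ε s t : ℝ} (hε : 0 < ε) (hs : ε ≤ s) (ht : ε ≤ t) :
    ‖hopfLax φ s - hopfLax φ t‖ ≤ Metric.diam (univ : Set X) ^ 2 / (2 * ε ^ 2) * |s - t| := by
  rw [ContinuousMap.norm_le _ (by positivity)]
  have key : ∀ s t, ε ≤ s → ε ≤ t → ∀ x, hopfLax φ s x - hopfLax φ t x ≤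
      Metric.diam (univ : Set X) ^ 2 / (2 * ε ^ 2) * |s - t| := by
    intro s t hs ht x
    obtain ⟨y, hy⟩ := exists_hopfLax_eq φ t x
    have h1 := hopfLax_le φ s x y
    have hs0 := hε.trans_le hs
    have ht0 := hε.trans_le ht
    have hd : dist x y ≤ Metric.diam (univ : Set X) :=
      Metric.dist_le_diam_of_mem isCompact_univ.isBounded (mem_univ x) (mem_univ y)
    have h2 : dist x y ^ 2 / (2 * s) - dist x y ^ 2 / (2 * t) =
        dist x y ^ 2 / (2 * (s * t)) * (t - s) := by field_simp
    have h3 : dist x y ^ 2 / (2 * (s * t)) ≤ Metric.diam (univ : Set X) ^ 2 / (2 * ε ^ 2) := by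
      have : ε ^ 2 ≤ s * t := by nlinarith
      gcongr
    have h4 : dist x y ^ 2 / (2 * (s * t)) * (t - s) ≤
        Metric.diam (univ : Set X) ^ 2 / (2 * ε ^ 2) * |s - t| := by
      rw [abs_sub_comm]
      exact (mul_le_mul_of_nonneg_left (le_abs_self _) (by positivity)).trans
        (mul_le_mul_of_nonneg_right h3 (abs_nonneg _))
    linarith
  intro x
  rw [Real.norm_eq_abs, ContinuousMap.sub_apply, abs_le]
  have h1 := key s t hs ht x
  have h2 := key t s ht hs x
  rw [abs_sub_comm t s] at h2
  constructor <;> linarith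

/-- Some minimizer `y` in the definition of `hopfLax φ t x`, namely one of maximal distance from
`x`, controls the slope at `x`. -/
theorem exists_hopfLax_eq_localSlope_le (φ : C(X, ℝ)) {t : ℝ} (ht : 0 < t) (x : X) :
    ∃ y, hopfLax φ t x = φ y + dist x y ^ 2 / (2 * t) ∧
      localSlope (hopfLax φ t) x ≤ ENNReal.ofReal (dist x y / t) := by
  have hcl : IsClosed {y | hopfLax φ t x = φ y + dist x y ^ 2 / (2 * t)} :=
    isClosed_eq continuous_const (continuous_hopfLax_cost φ t x)
  obtain ⟨y, hy, hmax⟩ := hcl.isCompact.exists_isMaxOn (exists_hopfLax_eq φ t x)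
    (Continuous.continuousOn (f := fun y => dist x y) (by fun_prop))
  refine ⟨y, hy, ?_⟩
  -- minimizers for points near `x` are not much farther from `x` than `y`
  have hnear : ∀ ε > 0, ∀ᶠ z in 𝓝 x, ∀ y', hopfLax φ t z = φ y' + dist z y' ^ 2 / (2 * t) →
      dist x y' < dist x y + ε := by
    intro ε hε
    have hK : IsCompact {y' | dist x y + ε ≤ dist x y'} :=
      (isClosed_le continuous_const (by fun_prop)).isCompact
    have := hK.eventually_forall_of_forall_eventually (x₀ := x)
      (P := fun z y' => hopfLax φ t z < φ y' + dist z y' ^ 2 / (2 * t)) ?_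
    · filter_upwards [this] with z hz y' hy'
      by_contra! hcon
      exact (hz y' hcon).ne hy'
    · intro y' hy'
      have hlt : hopfLax φ t x < φ y' + dist x y' ^ 2 / (2 * t) := by
        refine lt_of_le_of_ne (hopfLax_le φ t x y') fun heq => ?_
        have h1 : dist x y' ≤ dist x y := hmax heq
        have h2 : dist x y + ε ≤ dist x y' := hy'
        linarith
      exact (Continuous.tendsto (f := fun p : X × X => hopfLax φ t p.1) (by fun_prop) (x, y')
        ).eventually_lt (Continuous.tendsto
          (f := fun p : X × X => φ p.2 + dist p.1 p.2 ^ 2 / (2 * t)) (by fun_prop) (x, y')) hlt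
  have hbound : ∀ ε > 0, localSlope (hopfLax φ t) x ≤
      ENNReal.ofReal ((dist x y + 3 * ε) / t) := by
    intro ε hε
    refine limsup_le_of_le (by isBoundedDefault) ?_
    have hball : ∀ᶠ z in 𝓝 x, dist z x < ε := Metric.ball_mem_nhds x hε
    filter_upwards [nhdsWithin_le_nhds (hnear ε hε), nhdsWithin_le_nhds hball,
      self_mem_nhdsWithin] with z hz hzx hne
    have hpos : 0 < dist z x := dist_pos.2 hne
    obtain ⟨y', hy'⟩ := exists_hopfLax_eq φ t z
    have h1 := hopfLax_sub_le φ ht z hy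
    have h2 := hopfLax_sub_le φ ht x hy'
    rw [dist_comm x z] at h2
    have h3 := hz y' hy'
    have h4 : dist z y' ≤ dist z x + dist x y' := dist_triangle _ _ _
    have h5 : dist z x * ((dist x y + dist z x) / t) ≤
        dist z x * ((dist x y + 3 * ε) / t) :=
      mul_le_mul_of_nonneg_left (div_le_div_of_nonneg_right (by linarith) ht.le) hpos.le
    have h6 : dist z x * ((dist z y' + dist z x) / t) ≤
        dist z x * ((dist x y + 3 * ε) / t) :=
      mul_le_mul_of_nonneg_left (div_le_div_of_nonneg_right (by linarith) ht.le) hpos.le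
    rw [edist_dist, edist_dist, ← ENNReal.ofReal_div_of_pos hpos]
    refine ENNReal.ofReal_le_ofReal ?_
    rw [div_le_iff₀' hpos, Real.dist_eq, abs_le]
    constructor <;> linarith
  have hlim : Tendsto (fun ε : ℝ => ENNReal.ofReal ((dist x y + 3 * ε) / t)) (𝓝[>] 0)
      (𝓝 (ENNReal.ofReal (dist x y / t))) := by
    have : Continuous fun ε : ℝ => ENNReal.ofReal ((dist x y + 3 * ε) / t) :=
      ENNReal.continuous_ofReal.comp (by fun_prop)
    simpa using (this.tendsto 0).mono_left nhdsWithin_le_nhds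
  refine ge_of_tendsto hlim ?_
  filter_upwards [self_mem_nhdsWithin] with ε hε using hbound ε hε

/-- The Hamilton-Jacobi inequality, in integrated form for short times. -/
theorem hopfLax_add_sub_le (φ : C(X, ℝ)) {t δ : ℝ} (ht : 0 < t) (hδ : 0 < δ) (x : X) :
    hopfLax φ (t + δ) x - hopfLax φ t x ≤
      -(δ * t / (t + δ)) * (1 / 2 * (localSlope (hopfLax φ t) x).toReal ^ 2) := by
  obtain ⟨y, hy, hs⟩ := exists_hopfLax_eq_localSlope_le φ ht x
  have h1 := hopfLax_le φ (t + δ) x y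
  have h2 : (localSlope (hopfLax φ t) x).toReal ≤ dist x y / t :=
    ENNReal.toReal_le_of_le_ofReal (by positivity) hs
  have h3 : (localSlope (hopfLax φ t) x).toReal ^ 2 ≤ (dist x y / t) ^ 2 :=
    pow_le_pow_left₀ ENNReal.toReal_nonneg h2 2
  have h4 : dist x y ^ 2 / (2 * (t + δ)) - dist x y ^ 2 / (2 * t) =
      -(δ * t / (t + δ)) * (1 / 2 * (dist x y / t) ^ 2) := by
    field_simp; ring
  have h5 : δ * t / (t + δ) * (1 / 2 * (localSlope (hopfLax φ t) x).toReal ^ 2) ≤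
      δ * t / (t + δ) * (1 / 2 * (dist x y / t) ^ 2) := by gcongr
  linarith

/-- The triangle inequality. It follows from duality: the potential at the intermediate measure is
a Hopf-Lax function of the potential at the first one. -/
theorem W2_triangle [MeasurableSpace X] [BorelSpace X] (μ ρ ν : Measure X)
    [IsProbabilityMeasure μ] [IsProbabilityMeasure ρ] [IsProbabilityMeasure ν] :
    W2 μ ν ≤ W2 μ ρ + W2 ρ ν := by
  refine le_of_forall_pos_le_add fun ε hε => ?_
  obtain ⟨w₁, hw₁, hw₁'⟩ : ∃ w, 0 < w ∧ w = W2 μ ρ + ε / 2 :=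
    ⟨_, by have := W2_nonneg μ ρ; positivity, rfl⟩
  obtain ⟨w₂, hw₂, hw₂'⟩ : ∃ w, 0 < w ∧ w = W2 ρ ν + ε / 2 :=
    ⟨_, by have := W2_nonneg ρ ν; positivity, rfl⟩
  suffices W2 μ ν ^ 2 ≤ (w₁ + w₂) ^ 2 by
    have := (pow_le_pow_iff_left₀ (W2_nonneg μ ν) (by positivity) two_ne_zero).1 this
    linarith
  refine W2_sq_le μ ν fun φ ψ h => ?_
  set θ := hopfLax (-φ) (w₁ / (w₁ + w₂)) with hθ
  have h1 : ∀ x z, φ x + θ z ≤ (w₁ + w₂) / (2 * w₁) * dist x z ^ 2 := by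
    intro x z
    have := hopfLax_le (-φ) (w₁ / (w₁ + w₂)) z x
    rw [ContinuousMap.neg_apply, dist_comm] at this
    have e : dist x z ^ 2 / (2 * (w₁ / (w₁ + w₂))) = (w₁ + w₂) / (2 * w₁) * dist x z ^ 2 := by
      field_simp
    rw [e] at this
    linarith
  have h2 : ∀ z y, (-θ) z + ψ y ≤ (w₁ + w₂) / (2 * w₂) * dist z y ^ 2 := by
    intro z y
    obtain ⟨x, hx⟩ := exists_hopfLax_eq (-φ) (w₁ / (w₁ + w₂)) z
    rw [← hθ, ContinuousMap.neg_apply, dist_comm] at hx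
    rw [ContinuousMap.neg_apply, hx]
    have h3 := h x y
    have h4 : dist x y ^ 2 ≤ (dist x z + dist z y) ^ 2 :=
      pow_le_pow_left₀ dist_nonneg (dist_triangle _ _ _) 2
    have h5 : dist x z ^ 2 / (2 * (w₁ / (w₁ + w₂))) + (w₁ + w₂) / (2 * w₂) * dist z y ^ 2 -
        1 / 2 * (dist x z + dist z y) ^ 2 =
        (w₂ * dist x z - w₁ * dist z y) ^ 2 / (2 * w₁ * w₂) := by
      field_simp; ring
    have h6 : 0 ≤ (w₂ * dist x z - w₁ * dist z y) ^ 2 / (2 * w₁ * w₂) := by positivity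
    linarith
  have h3 := integral_add_le_W2_sq μ ρ (by positivity) h1
  have h4 := integral_add_le_W2_sq ρ ν (by positivity) h2
  simp only [ContinuousMap.neg_apply, integral_neg] at h4
  have h5 : (w₁ + w₂) / (2 * w₁) * W2 μ ρ ^ 2 ≤ (w₁ + w₂) / (2 * w₁) * w₁ ^ 2 := by
    have := W2_nonneg μ ρ
    gcongr; linarith
  have h6 : (w₁ + w₂) / (2 * w₂) * W2 ρ ν ^ 2 ≤ (w₁ + w₂) / (2 * w₂) * w₂ ^ 2 := by
    have := W2_nonneg ρ ν
    gcongr; linarith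
  have h7 : (w₁ + w₂) / (2 * w₁) * w₁ ^ 2 + (w₁ + w₂) / (2 * w₂) * w₂ ^ 2 =
      1 / 2 * (w₁ + w₂) ^ 2 := by field_simp
  linarith

end HopfLax

/-! ### Weak convergence in a Hilbert space -/

/-- Bounded sequences in a separable Hilbert space have weakly convergent subsequences. -/
theorem exists_subseq_tendsto_inner {H : Type*} [NormedAddCommGroup H] [InnerProductSpace ℝ H]
    [CompleteSpace H] [TopologicalSpace.SeparableSpace H] {s : ℕ → H} {M : ℝ}
    (hs : ∀ n, ‖s n‖ ≤ M) :
    ∃ (a : H) (σ : ℕ → ℕ), StrictMono σ ∧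
      ∀ h, Tendsto (fun n => inner ℝ h (s (σ n))) atTop (𝓝 (inner ℝ h a)) := by
  let x : ℕ → WeakDual ℝ H := fun n => StrongDual.toWeakDual (InnerProductSpace.toDual ℝ H (s n))
  have hx : ∀ n, x n ∈ WeakDual.toStrongDual ⁻¹' Metric.closedBall (0 : StrongDual ℝ H) M := by
    intro n
    rw [mem_preimage, mem_closedBall_zero_iff]
    exact ((InnerProductSpace.toDual ℝ H).norm_map (s n)).trans_le (hs n)
  obtain ⟨y, -, σ, hσ, hlim⟩ := WeakDual.isSeqCompact_closedBall ℝ H 0 M hx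
  refine ⟨(InnerProductSpace.toDual ℝ H).symm (WeakDual.toStrongDual y), σ, hσ, fun h => ?_⟩
  rw [real_inner_comm, InnerProductSpace.toDual_symm_apply]
  have := ((WeakDual.eval_continuous h).tendsto y).comp hlim
  refine this.congr fun n => ?_
  simp only [Function.comp, x]
  rw [real_inner_comm]
  exact InnerProductSpace.toDual_apply_apply

/-! ### The slope of Lipschitz functions -/

section Slope

variable {X : Type*} [MetricSpace X]

theorem localSlope_le_of_lipschitzWith {g : X → ℝ} {K : NNReal} (hg : LipschitzWith K g) (x : X) :
    localSlope g x ≤ K := by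
  refine limsup_le_of_le (by isBoundedDefault) ?_
  filter_upwards [self_mem_nhdsWithin] with y hy
  exact ENNReal.div_le_of_le_mul (hg y x)

theorem localSlope_ne_top {g : X → ℝ} (hg : ∃ K, LipschitzWith K g) (x : X) :
    localSlope g x ≠ ⊤ := by
  obtain ⟨K, hK⟩ := hg
  exact ((localSlope_le_of_lipschitzWith hK x).trans_lt ENNReal.coe_lt_top).ne

theorem localSlope_mono {f g : X → ℝ} (h : ∀ x y, edist (f y) (f x) ≤ edist (g y) (g x)) (x : X) :
    localSlope f x ≤ localSlope g x :=
  limsup_le_limsup (Eventually.of_forall fun y => ENNReal.div_le_div_right (h x y) _)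

theorem localSlope_add_le (f g : X → ℝ) (x : X) :
    localSlope (f + g) x ≤ localSlope f x + localSlope g x := by
  refine ENNReal.le_of_forall_pos_le_add fun ε hε hfin => ?_
  obtain ⟨h1, h2⟩ := ENNReal.add_lt_top.1 hfin
  have hε' : (ε / 2 : ℝ≥0∞) ≠ 0 := by simpa using hε.ne'
  refine limsup_le_of_le (by isBoundedDefault) ?_
  filter_upwards [eventually_lt_of_limsup_lt (ENNReal.lt_add_right h1.ne hε'),
    eventually_lt_of_limsup_lt (ENNReal.lt_add_right h2.ne hε')] with y h3 h4
  calc edist ((f + g) y) ((f + g) x) / edist y x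
      ≤ (edist (f y) (f x) + edist (g y) (g x)) / edist y x :=
        ENNReal.div_le_div_right (edist_add_add_le _ _ _ _) _
    _ = edist (f y) (f x) / edist y x + edist (g y) (g x) / edist y x := ENNReal.add_div
    _ ≤ (localSlope f x + ε / 2) + (localSlope g x + ε / 2) := add_le_add h3.le h4.le
    _ = localSlope f x + localSlope g x + ε := by rw [add_add_add_comm, ENNReal.add_halves]

theorem localSlope_smul_le (a : ℝ) (g : X → ℝ) (x : X) :
    localSlope (a • g) x ≤ ‖a‖ₑ * localSlope g x := by
  rw [localSlope, localSlope, ← ENNReal.limsup_const_mul_of_ne_top (by simp)]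
  refine limsup_le_limsup (Eventually.of_forall fun y => ?_)
  simp only [Pi.smul_apply]
  rw [edist_smul₀, ENNReal.smul_def, smul_eq_mul, mul_div_assoc]
  rfl

theorem toReal_localSlope_add_smul_le {f g : X → ℝ} (hf : ∃ K, LipschitzWith K f)
    (hg : ∃ K, LipschitzWith K g) {a b : ℝ} (ha : 0 ≤ a) (hb : 0 ≤ b) (x : X) :
    (localSlope (a • f + b • g) x).toReal ≤
      a * (localSlope f x).toReal + b * (localSlope g x).toReal := by
  have hf' := localSlope_ne_top hf x
  have hg' := localSlope_ne_top hg x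
  have h1 := (localSlope_add_le (a • f) (b • g) x).trans
    (add_le_add (localSlope_smul_le a f x) (localSlope_smul_le b g x))
  have h2 := ENNReal.toReal_mono (by finiteness) h1
  rw [ENNReal.toReal_add (by finiteness) (by finiteness), ENNReal.toReal_mul,
    ENNReal.toReal_mul] at h2
  simpa [abs_of_nonneg ha, abs_of_nonneg hb] using h2

/-- The slope is a decreasing limit of suprema over punctured balls of radii `1 / (n + 1)`, which
are lower semicontinuous in the center. -/
theorem measurable_localSlope [MeasurableSpace X] [OpensMeasurableSpace X] {g : X → ℝ}
    (hg : Continuous g) : Measurable (localSlope g) := by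
  have h : localSlope g = fun x => ⨅ n : ℕ, ⨆ y ∈ Metric.ball x (1 / ((n : ℝ) + 1)) ∩ {x}ᶜ,
      edist (g y) (g x) / edist y x := by
    ext x
    rw [localSlope, (nhdsWithin_hasBasis Metric.nhds_basis_ball_inv_nat_succ
      _).limsup_eq_iInf_iSup]
    simp
  rw [h]
  refine Measurable.iInf fun n => LowerSemicontinuous.measurable ?_
  intro x a ha
  obtain ⟨y, hy⟩ := lt_iSup_iff.1 ha
  obtain ⟨hmem, hlt⟩ := lt_iSup_iff.1 hy
  have h1 : ∀ᶠ z in 𝓝 x, a < edist (g y) (g z) / edist y z := by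
    refine Tendsto.eventually_const_lt hlt (ENNReal.Tendsto.div ?_ (Or.inr ?_) ?_ (Or.inr ?_))
    · exact Continuous.tendsto (f := fun z => edist (g y) (g z)) (by fun_prop) x
    · exact edist_pos.2 hmem.2 |>.ne'
    · exact Continuous.tendsto (f := fun z => edist y z) (by fun_prop) x
    · exact edist_ne_top _ _
  have h2 : ∀ᶠ z in 𝓝 x, dist y z < 1 / ((n : ℝ) + 1) :=
    (Continuous.tendsto (f := fun z => dist y z) (by fun_prop) x).eventually_lt_const hmem.1
  have h3 : ∀ᶠ z in 𝓝 x, z ≠ y := isOpen_ne.mem_nhds (fun h => hmem.2 h.symm)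
  filter_upwards [h1, h2, h3] with z h1 h2 h3
  exact h1.trans_le (le_iSup₂_of_le y ⟨h2, fun h => h3 h.symm⟩ le_rfl)

variable [CompactSpace X] [MeasurableSpace X] [BorelSpace X]

theorem memLp_lipschitz (m : Measure X) [IsFiniteMeasure m] {g : X → ℝ}
    (hg : ∃ K, LipschitzWith K g) : MemLp g 2 m := by
  obtain ⟨K, hK⟩ := hg
  obtain ⟨C, hC⟩ := isCompact_univ.exists_bound_of_continuousOn hK.continuous.continuousOn
  exact MemLp.of_bound hK.continuous.aestronglyMeasurable C (ae_of_all _ fun x => hC x (mem_univ x))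

theorem memLp_localSlope (m : Measure X) [IsFiniteMeasure m] {g : X → ℝ}
    (hg : ∃ K, LipschitzWith K g) : MemLp (fun x => (localSlope g x).toReal) 2 m := by
  obtain ⟨K, hK⟩ := hg
  refine MemLp.of_bound
    (measurable_localSlope hK.continuous).ennreal_toReal.aestronglyMeasurable K
    (ae_of_all _ fun x => ?_)
  rw [Real.norm_eq_abs, abs_of_nonneg ENNReal.toReal_nonneg]
  exact ENNReal.toReal_mono ENNReal.coe_ne_top (localSlope_le_of_lipschitzWith hK x)

end Slope

/-! ### Relaxed slopes -/

theorem L2_inner_eq {X : Type*} [MeasurableSpace X] {m : Measure X} (f g : Lp ℝ 2 m) :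
    inner ℝ f g = ∫ x, f x * g x ∂m := by
  rw [L2.inner_def]
  simp [mul_comm]

theorem L2_norm_sq_eq {X : Type*} [MeasurableSpace X] {m : Measure X} (f : Lp ℝ 2 m) :
    ‖f‖ ^ 2 = ∫ x, f x ^ 2 ∂m := by
  rw [← real_inner_self_eq_norm_sq, L2_inner_eq]
  simp [sq]

theorem L2_integrable_mul {X : Type*} [MeasurableSpace X] {m : Measure X} (f g : Lp ℝ 2 m) :
    Integrable (fun x => f x * g x) m :=
  (Lp.memLp f).integrable_mul (Lp.memLp g)

theorem L2_inner_toLp {X : Type*} [MeasurableSpace X] {m : Measure X} (f : Lp ℝ 2 m) {g : X → ℝ}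
    (hg : MemLp g 2 m) : inner ℝ f (hg.toLp g) = ∫ x, f x * g x ∂m := by
  rw [L2_inner_eq]
  exact integral_congr_ae (by filter_upwards [hg.coeFn_toLp] with x hx; rw [hx])

section Relaxed

variable {X : Type*} [MetricSpace X] [CompactSpace X] [MeasurableSpace X] [BorelSpace X]
  (m : Measure X) [IsProbabilityMeasure m]

/-- The pairs of (the class of) a Lipschitz function and an upper bound for its slope. This set is
convex, and its closure is the set of pairs of a function and a relaxed slope. -/
def slopePairs : Set (Lp ℝ 2 m × Lp ℝ 2 m) :=
  {p | ∃ g : X → ℝ, (∃ K, LipschitzWith K g) ∧ p.1 =ᵐ[m] g ∧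
    ∀ᵐ x ∂m, (localSlope g x).toReal ≤ p.2 x}

theorem lipschitz_add_smul {f g : X → ℝ} (hf : ∃ K, LipschitzWith K f)
    (hg : ∃ K, LipschitzWith K g) (a b : ℝ) : ∃ K, LipschitzWith K (a • f + b • g) := by
  obtain ⟨K, hK⟩ := hf
  obtain ⟨K', hK'⟩ := hg
  exact ⟨_, ((lipschitzWith_smul a).comp hK).add ((lipschitzWith_smul b).comp hK')⟩

variable {m}

theorem add_smul_mem_slopePairs {p q : Lp ℝ 2 m × Lp ℝ 2 m} (hp : p ∈ slopePairs m)
    (hq : q ∈ slopePairs m) {a b : ℝ} (ha : 0 ≤ a) (hb : 0 ≤ b) :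
    a • p + b • q ∈ slopePairs m := by
  obtain ⟨f, hf, hpf, hps⟩ := hp
  obtain ⟨g, hg, hqg, hqs⟩ := hq
  refine ⟨a • f + b • g, lipschitz_add_smul hf hg a b, ?_, ?_⟩
  · filter_upwards [hpf, hqg, Lp.coeFn_add (a • p.1) (b • q.1), Lp.coeFn_smul a p.1,
      Lp.coeFn_smul b q.1] with x h1 h2 h3 h4 h5
    simp only [Prod.fst_add, Prod.smul_fst, Pi.add_apply, Pi.smul_apply] at *
    rw [h3, h4, h5, h1, h2]
  · filter_upwards [hps, hqs, Lp.coeFn_add (a • p.2) (b • q.2), Lp.coeFn_smul a p.2,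
      Lp.coeFn_smul b q.2] with x h1 h2 h3 h4 h5
    simp only [Prod.snd_add, Prod.smul_snd, Pi.add_apply, Pi.smul_apply, smul_eq_mul] at *
    rw [h3, h4, h5]
    refine (toReal_localSlope_add_smul_le hf hg ha hb x).trans ?_
    gcongr

theorem convex_slopePairs : Convex ℝ (slopePairs m) :=
  fun _ hp _ hq _ _ ha hb _ => add_smul_mem_slopePairs hp hq ha hb

theorem mem_slopePairs_of_lipschitz {g : X → ℝ} (hg : ∃ K, LipschitzWith K g) :
    ((memLp_lipschitz m hg).toLp g, (memLp_localSlope m hg).toLp _) ∈ slopePairs m :=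
  ⟨g, hg, (memLp_lipschitz m hg).coeFn_toLp,
    (memLp_localSlope m hg).coeFn_toLp.mono fun _ hx => hx.ge⟩

/-- Relaxed slopes are characterized by strong instead of weak approximation. One direction is
weak compactness, the other one is Mazur's lemma. -/
theorem isRelaxedSlope_iff {f G : Lp ℝ 2 m} :
    IsRelaxedSlope m f G ↔ (f, G) ∈ closure (slopePairs m) := by
  constructor
  · rintro ⟨G', g, hg, hlim, hweak, hle⟩
    have hlim' : Tendsto (fun n => (memLp_lipschitz m (hg n)).toLp (g n)) atTop (𝓝 f) := by
      have := (Lp.tendsto_Lp_iff_tendsto_eLpNorm'' g (fun n => memLp_lipschitz m (hg n)) f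
        (Lp.memLp f)).2 hlim
      rwa [Lp.toLp_coeFn] at this
    -- a weak limit of elements of a convex set cannot be separated from its closure
    have h1 : (f, G') ∈ closure (slopePairs m) := by
      by_contra hcon
      obtain ⟨L, u, hL, hu⟩ := geometric_hahn_banach_closed_point
        convex_slopePairs.closure isClosed_closure hcon
      let L₂ : StrongDual ℝ (Lp ℝ 2 m) := L.comp (ContinuousLinearMap.inr ℝ _ _)
      let w : Lp ℝ 2 m := (InnerProductSpace.toDual ℝ _).symm L₂
      have hw : ∀ h, L (0, h) = inner ℝ w h := fun h => by
        rw [InnerProductSpace.toDual_symm_apply]; rfl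
      have hsplit : ∀ a b, L (a, b) = L (a, 0) + inner ℝ w b := fun a b => by
        rw [← hw, ← map_add, Prod.mk_add_mk, add_zero, zero_add]
      have hconv : Tendsto (fun n => L ((memLp_lipschitz m (hg n)).toLp (g n),
          (memLp_localSlope m (hg n)).toLp _)) atTop (𝓝 (L (f, G'))) := by
        simp_rw [hsplit _ (MemLp.toLp _ _)]
        rw [hsplit f G', L2_inner_eq]
        refine Tendsto.add ?_ ?_
        · exact ((L.continuous.comp (by fun_prop :
            Continuous fun a : Lp ℝ 2 m => (a, (0 : Lp ℝ 2 m)))).tendsto f).comp hlim'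
        · simp_rw [L2_inner_toLp]
          exact hweak w
      exact hu.not_ge (le_of_tendsto' hconv fun n =>
        (hL _ (subset_closure (mem_slopePairs_of_lipschitz (hg n)))).le)
    have h2 := map_mem_closure (f := fun p : Lp ℝ 2 m × Lp ℝ 2 m => (p.1, p.2 + (G - G')))
      (by fun_prop) h1 (t := slopePairs m) ?_
    · simpa using h2
    rintro p ⟨g, hg, hpg, hps⟩
    refine ⟨g, hg, hpg, ?_⟩
    filter_upwards [hps, hle, Lp.coeFn_add p.2 (G - G'), Lp.coeFn_sub G G'] with x h1 h2 h3 h4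
    simp only [Pi.add_apply, Pi.sub_apply] at *
    rw [h3, h4]; linarith
  · intro hmem
    obtain ⟨p, hp, hlim⟩ := mem_closure_iff_seq_limit.1 hmem
    choose g hg hpg hps using hp
    have hlim1 : Tendsto (fun n => (p n).1) atTop (𝓝 f) := (continuous_fst.tendsto _).comp hlim
    have hlim2 : Tendsto (fun n => (p n).2) atTop (𝓝 G) := (continuous_snd.tendsto _).comp hlim
    let s : ℕ → Lp ℝ 2 m := fun n => (memLp_localSlope m (hg n)).toLp _
    have hs : ∀ n, ∀ᵐ x ∂m, s n x = (localSlope (g n) x).toReal := fun n =>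
      (memLp_localSlope m (hg n)).coeFn_toLp
    obtain ⟨M, hM⟩ := hlim2.norm.bddAbove_range
    have hsM : ∀ n, ‖s n‖ ≤ M := by
      intro n
      refine (Lp.norm_le_norm_of_ae_le ?_).trans (hM ⟨n, rfl⟩)
      filter_upwards [hs n, hps n] with x h1 h2
      rw [h1, Real.norm_eq_abs, Real.norm_eq_abs, abs_of_nonneg ENNReal.toReal_nonneg]
      exact h2.trans (le_abs_self _)
    have : Fact ((2 : ℝ≥0∞) ≠ ⊤) := ⟨by simp⟩
    obtain ⟨G', σ, hσ, hweak⟩ := exists_subseq_tendsto_inner hsM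
    refine ⟨G', fun n => g (σ n), fun n => hg _, ?_, fun h => ?_, ?_⟩
    · have := (Lp.tendsto_Lp_iff_tendsto_eLpNorm' _ _).1 (hlim1.comp hσ.tendsto_atTop)
      refine this.congr fun n => eLpNorm_congr_ae ?_
      filter_upwards [hpg (σ n)] with x hx
      simp only [Function.comp, Pi.sub_apply, hx]
    · have := hweak h
      rw [L2_inner_eq] at this
      refine this.congr fun n => ?_
      exact L2_inner_toLp h _
    -- the inequality between slopes and bounds is tested with the positive part of `G' - G`
    · have hle : ∀ h : Lp ℝ 2 m, (∀ᵐ x ∂m, 0 ≤ h x) → inner ℝ h G' ≤ inner ℝ h G := by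
        intro h hh
        refine le_of_tendsto_of_tendsto' (hweak h)
          ((tendsto_const_nhds.inner hlim2).comp hσ.tendsto_atTop) fun n => ?_
        rw [Function.comp, L2_inner_eq, L2_inner_eq]
        refine integral_mono_ae (L2_integrable_mul _ _) (L2_integrable_mul _ _) ?_
        filter_upwards [hh, hs (σ n), hps (σ n)] with x h1 h2 h3
        rw [h2]
        exact mul_le_mul_of_nonneg_left h3 h1
      have hsup : ∀ᵐ x ∂m, ((G' - G) ⊔ 0 : Lp ℝ 2 m) x = max (G' x - G x) 0 := by
        filter_upwards [Lp.coeFn_sup (G' - G) 0, Lp.coeFn_sub G' G,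
          Lp.coeFn_zero ℝ 2 m] with x h1 h2 h3
        rw [h1, Pi.sup_apply, h2, h3]; rfl
      have h1 := hle ((G' - G) ⊔ 0) (by filter_upwards [hsup] with x hx; rw [hx]; simp)
      have h2 : ‖((G' - G) ⊔ 0 : Lp ℝ 2 m)‖ ^ 2 ≤ 0 := by
        rw [← sub_nonpos, ← inner_sub_right, L2_inner_eq] at h1
        rw [L2_norm_sq_eq]
        refine le_of_eq_of_le (integral_congr_ae ?_) h1
        filter_upwards [hsup, Lp.coeFn_sub G' G] with x h1 h2
        rw [h1, h2, Pi.sub_apply]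
        rcases le_total (G' x - G x) 0 with h | h
        · simp [max_eq_right h]
        · rw [max_eq_left h]; ring
      have h3 : ((G' - G) ⊔ 0 : Lp ℝ 2 m) = 0 := by
        rw [← norm_eq_zero]
        exact pow_eq_zero_iff two_ne_zero |>.1 (le_antisymm h2 (sq_nonneg _))
      filter_upwards [hsup, Lp.coeFn_zero ℝ 2 m] with x h4 h5
      rw [h3, h5] at h4
      have := le_max_left (G' x - G x) 0
      rw [← h4] at this
      simp only [Pi.zero_apply] at this
      linarith

theorem IsRelaxedSlope.add_smul {f G f' G' : Lp ℝ 2 m} (h : IsRelaxedSlope m f G)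
    (h' : IsRelaxedSlope m f' G') {a b : ℝ} (ha : 0 ≤ a) (hb : 0 ≤ b) :
    IsRelaxedSlope m (a • f + b • f') (a • G + b • G') := by
  rw [isRelaxedSlope_iff] at *
  exact map_mem_closure₂ (f := fun p q : Lp ℝ 2 m × Lp ℝ 2 m => a • p + b • q) (by fun_prop) h h'
    fun p hp q hq => add_smul_mem_slopePairs hp hq ha hb

theorem isRelaxedSlope_of_lipschitz {g : X → ℝ} (hg : ∃ K, LipschitzWith K g) :
    IsRelaxedSlope m ((memLp_lipschitz m hg).toLp g) ((memLp_localSlope m hg).toLp _) :=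
  isRelaxedSlope_iff.2 (subset_closure (mem_slopePairs_of_lipschitz hg))

theorem localSlope_const (c : ℝ) (x : X) : localSlope (fun _ : X => c) x = 0 := by
  have := localSlope_le_of_lipschitzWith (LipschitzWith.const c) x
  simpa using this

theorem isRelaxedSlope_const (c : ℝ) : IsRelaxedSlope m (Lp.const 2 m c) 0 := by
  refine isRelaxedSlope_iff.2 (subset_closure ⟨fun _ => c, ⟨0, LipschitzWith.const c⟩,
    Lp.coeFn_const 2 m c, ?_⟩)
  filter_upwards [Lp.coeFn_zero ℝ 2 m] with x hx
  rw [hx, localSlope_const]; simp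

/-- Truncation does not increase relaxed slopes. -/
theorem IsRelaxedSlope.sup_const {f G : Lp ℝ 2 m} (h : IsRelaxedSlope m f G) (c : ℝ) :
    IsRelaxedSlope m (f ⊔ Lp.const 2 m c) G := by
  rw [isRelaxedSlope_iff] at *
  have hcont : Continuous fun f : Lp ℝ 2 m => f ⊔ Lp.const 2 m c := by fun_prop
  refine map_mem_closure (f := fun p : Lp ℝ 2 m × Lp ℝ 2 m => (p.1 ⊔ Lp.const 2 m c, p.2))
    (by fun_prop) h ?_
  rintro p ⟨g, ⟨K, hK⟩, hpg, hps⟩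
  refine ⟨fun x => max (g x) c, ⟨K, hK.max_const c⟩, ?_, ?_⟩
  · filter_upwards [hpg, Lp.coeFn_sup p.1 (Lp.const 2 m c), Lp.coeFn_const 2 m c] with x h1 h2 h3
    simp only [h2, Pi.sup_apply, h1, h3, Function.const_apply]
  · filter_upwards [hps] with x hx
    refine (ENNReal.toReal_mono (localSlope_ne_top ⟨K, hK⟩ x) (localSlope_mono ?_ x)).trans hx
    intro x y
    rw [edist_dist, edist_dist]
    refine ENNReal.ofReal_le_ofReal ?_
    exact abs_max_sub_max_le_abs _ _ _

/-! ### The minimal relaxed slope -/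

theorem exists_isMinimalRelaxedSlope {f G : Lp ℝ 2 m} (h : IsRelaxedSlope m f G) :
    ∃ G, IsMinimalRelaxedSlope m f G := by
  have hconv : Convex ℝ {G | IsRelaxedSlope m f G} := by
    intro G₁ h₁ G₂ h₂ a b ha hb hab
    have := IsRelaxedSlope.add_smul h₁ h₂ ha hb
    rwa [← add_smul, hab, one_smul] at this
  have hcl : IsClosed {G | IsRelaxedSlope m f G} := by
    simp_rw [isRelaxedSlope_iff]
    exact isClosed_closure.preimage (by fun_prop : Continuous fun G : Lp ℝ 2 m => (f, G))
  obtain ⟨G₀, hG₀, hmin⟩ := exists_norm_eq_iInf_of_complete_convex ⟨G, h⟩ hcl.isComplete hconv 0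
  refine ⟨G₀, hG₀, fun G₁ hG₁ => ?_⟩
  simp only [zero_sub, norm_neg] at hmin
  rw [hmin]
  exact ciInf_le ⟨0, by rintro _ ⟨G, rfl⟩; exact norm_nonneg _⟩
    (⟨G₁, hG₁⟩ : {G | IsRelaxedSlope m f G})

theorem isMinimalRelaxedSlope_minimalRelaxedSlope {f : Lp ℝ 2 m}
    (h : ∃ G, IsRelaxedSlope m f G) : IsMinimalRelaxedSlope m f (minimalRelaxedSlope m f) := by
  obtain ⟨G, hG⟩ := h
  have := exists_isMinimalRelaxedSlope hG
  rw [minimalRelaxedSlope, dif_pos this]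
  exact this.choose_spec

theorem cheegerEnergy_eq {f : Lp ℝ 2 m} (h : ∃ G, IsRelaxedSlope m f G) :
    cheegerEnergy m f = ((1 / 2 * ‖minimalRelaxedSlope m f‖ ^ 2 : ℝ) : EReal) := by
  rw [cheegerEnergy, if_pos h, L2_norm_sq_eq]

theorem exists_isRelaxedSlope_of_mem_subdifferential {f ξ : Lp ℝ 2 m}
    (h : ξ ∈ subdifferential (cheegerEnergy m) f) : ∃ G, IsRelaxedSlope m f G := by
  by_contra hcon
  exact h.1 (by rw [cheegerEnergy, if_neg hcon])

/-- The subgradient inequality for the Cheeger energy, tested with any relaxed slope. -/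
theorem add_inner_le_of_mem_subdifferential {f ξ : Lp ℝ 2 m}
    (h : ξ ∈ subdifferential (cheegerEnergy m) f) {g G : Lp ℝ 2 m} (hG : IsRelaxedSlope m g G) :
    1 / 2 * ‖minimalRelaxedSlope m f‖ ^ 2 + inner ℝ ξ (g - f) ≤ 1 / 2 * ‖G‖ ^ 2 := by
  have h1 := h.2 g
  rw [cheegerEnergy_eq (exists_isRelaxedSlope_of_mem_subdifferential h),
    cheegerEnergy_eq ⟨G, hG⟩, ← EReal.coe_add, EReal.coe_le_coe_iff] at h1
  have h2 := (isMinimalRelaxedSlope_minimalRelaxedSlope ⟨G, hG⟩).2 G hG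
  have h3 := pow_le_pow_left₀ (norm_nonneg _) h2 2
  linarith

/-- Integration by parts, as an inequality: the derivative of the energy in the direction of a
Lipschitz function `g` is at most `∫ |Dg| |Df|_*`. -/
theorem inner_le_inner_localSlope {f ξ : Lp ℝ 2 m}
    (h : ξ ∈ subdifferential (cheegerEnergy m) f) {g : X → ℝ} (hg : ∃ K, LipschitzWith K g) :
    inner ℝ ξ ((memLp_lipschitz m hg).toLp g) ≤
      inner ℝ (minimalRelaxedSlope m f) ((memLp_localSlope m hg).toLp _) := by
  set γ := (memLp_lipschitz m hg).toLp g
  set S := (memLp_localSlope m hg).toLp _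
  set G := minimalRelaxedSlope m f
  have hG := (isMinimalRelaxedSlope_minimalRelaxedSlope
    (exists_isRelaxedSlope_of_mem_subdifferential h)).1
  have key : ∀ ε : ℝ, 0 < ε → inner ℝ ξ γ ≤ inner ℝ G S + ε / 2 * ‖S‖ ^ 2 := by
    intro ε hε
    have h1 := add_inner_le_of_mem_subdifferential h
      (hG.add_smul (isRelaxedSlope_of_lipschitz hg) zero_le_one hε.le)
    rw [one_smul, one_smul, add_sub_cancel_left, inner_smul_right, norm_add_sq_real,
      inner_smul_right, norm_smul, Real.norm_eq_abs, mul_pow, sq_abs] at h1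
    have h2 : ε * inner ℝ ξ γ ≤ ε * (inner ℝ G S + ε / 2 * ‖S‖ ^ 2) := by
      simp only [γ, G, S]; linarith
    exact le_of_mul_le_mul_left h2 hε
  have hlim : Tendsto (fun ε : ℝ => inner ℝ G S + ε / 2 * ‖S‖ ^ 2) (𝓝[>] 0)
      (𝓝 (inner ℝ G S)) := by
    have : Continuous fun ε : ℝ => inner ℝ G S + ε / 2 * ‖S‖ ^ 2 := by fun_prop
    simpa using (this.tendsto 0).mono_left nhdsWithin_le_nhds
  refine ge_of_tendsto hlim ?_
  filter_upwards [self_mem_nhdsWithin] with ε hε using key ε hε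

/-- Quantitative continuity of the minimal relaxed slope at points with subgradients: the midpoint
of the two minimal relaxed slopes is a competitor at the midpoint of the two functions. -/
theorem norm_minimalRelaxedSlope_sub_sq_le {f g ξ η : Lp ℝ 2 m}
    (hf : ξ ∈ subdifferential (cheegerEnergy m) f) (hg : η ∈ subdifferential (cheegerEnergy m) g) :
    ‖minimalRelaxedSlope m f - minimalRelaxedSlope m g‖ ^ 2 ≤ 4 * (‖ξ‖ + ‖η‖) * ‖f - g‖ := by
  have hF := (isMinimalRelaxedSlope_minimalRelaxedSlope
    (exists_isRelaxedSlope_of_mem_subdifferential hf)).1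
  have hG := (isMinimalRelaxedSlope_minimalRelaxedSlope
    (exists_isRelaxedSlope_of_mem_subdifferential hg)).1
  set F := minimalRelaxedSlope m f
  set G := minimalRelaxedSlope m g
  have h1 := add_inner_le_of_mem_subdifferential hf hG
  have h2 := add_inner_le_of_mem_subdifferential hg
    (hF.add_smul hG (a := 1 / 2) (b := 1 / 2) (by norm_num) (by norm_num))
  have e : (1 / 2 : ℝ) • f + (1 / 2 : ℝ) • g - g = (1 / 2 : ℝ) • (f - g) := by
    module
  rw [e, ← smul_add, inner_smul_right, norm_smul, mul_pow, Real.norm_eq_abs, sq_abs] at h2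
  have h3 := parallelogram_law_with_norm ℝ F G
  have h4 : -inner ℝ ξ (g - f) ≤ ‖ξ‖ * ‖f - g‖ := by
    rw [← inner_neg_right, neg_sub]; exact real_inner_le_norm _ _
  have h5 : -inner ℝ η (f - g) ≤ ‖η‖ * ‖f - g‖ := by
    rw [← inner_neg_right, ← norm_neg (f - g)]; exact real_inner_le_norm _ _
  nlinarith [mul_nonneg (norm_nonneg ξ) (norm_nonneg (f - g)),
    mul_nonneg (norm_nonneg η) (norm_nonneg (f - g))]

end Relaxed

/-! ### The gradient flow of the Cheeger energy -/

section Flow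

variable {X : Type*} [MetricSpace X] [CompactSpace X] [MeasurableSpace X] [BorelSpace X]
  {m : Measure X} [IsProbabilityMeasure m] {f₀ : Lp ℝ 2 m} {f : ℝ → Lp ℝ 2 m}

/-- The positive times at which the curve `f` solves the gradient flow inclusion. -/
def regularTimes (m : Measure X) (f : ℝ → Lp ℝ 2 m) : Set ℝ :=
  {t | 0 < t ∧ ∃ f' : Lp ℝ 2 m, HasDerivAt f f' t ∧ -f' ∈ subdifferential (cheegerEnergy m) (f t)}

theorem ae_mem_regularTimes (hf : IsGradientFlow (cheegerEnergy m) f₀ f) :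
    ∀ᵐ t ∂(volume.restrict (Ioi (0 : ℝ))), t ∈ regularTimes m f := by
  filter_upwards [hf.deriv_mem, self_mem_ae_restrict measurableSet_Ioi] with t h1 h2
  exact ⟨h2, h1⟩

/-- The minimum principle: the truncation `g ↦ max g c` is a nearest point map in `L²` that does
not increase the energy. -/
theorem ae_const_le_flow (hf : IsGradientFlow (cheegerEnergy m) f₀ f) {c : ℝ}
    (hc : ∀ᵐ x ∂m, c ≤ f₀ x) {t : ℝ} (ht : 0 ≤ t) : ∀ᵐ x ∂m, c ≤ f t x := by
  have hsup : ∀ g : Lp ℝ 2 m, ∀ᵐ x ∂m, (g ⊔ Lp.const 2 m c : Lp ℝ 2 m) x = max (g x) c := by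
    intro g
    filter_upwards [Lp.coeFn_sup g (Lp.const 2 m c), Lp.coeFn_const 2 m c] with x h1 h2
    rw [h1, Pi.sup_apply, h2]; rfl
  have key := norm_sub_nearest_le hf.continuousOn hf.locallyLipschitz
    (P := fun g => g ⊔ Lp.const 2 m c) (fun g h => ?_) ?_ ht
  · have h0 : f₀ - f₀ ⊔ Lp.const 2 m c = 0 := by
      rw [sub_eq_zero]
      refine Lp.ext ?_
      filter_upwards [hsup f₀, hc] with x h1 h2
      rw [h1, max_eq_left h2]
    rw [hf.initial, h0, norm_zero, norm_le_zero_iff, sub_eq_zero] at key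
    filter_upwards [hsup (f t)] with x hx
    rw [← key] at hx
    rw [hx]
    exact le_max_right _ _
  · refine Lp.norm_le_norm_of_ae_le ?_
    filter_upwards [hsup g, hsup h, Lp.coeFn_sub g (g ⊔ Lp.const 2 m c),
      Lp.coeFn_sub g (h ⊔ Lp.const 2 m c)] with x h1 h2 h3 h4
    rw [h3, h4, Pi.sub_apply, Pi.sub_apply, h1, h2, Real.norm_eq_abs, Real.norm_eq_abs]
    rcases le_total (g x) c with hgc | hgc
    · rw [max_eq_right hgc, abs_of_nonpos (by linarith)]
      have := neg_le_abs (g x - max (h x) c)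
      linarith [le_max_right (h x) c]
    · simp [max_eq_left hgc]
  · filter_upwards [hf.deriv_mem] with s ⟨u', hu', hmem⟩
    refine ⟨u', hu', ?_⟩
    have hG := (isMinimalRelaxedSlope_minimalRelaxedSlope
      (exists_isRelaxedSlope_of_mem_subdifferential hmem)).1
    have := add_inner_le_of_mem_subdifferential hmem (hG.sup_const c)
    rw [inner_neg_left, ← inner_neg_right, neg_sub] at this
    linarith

/-- Conservation of mass: adding a constant does not change the energy, so that subgradients have
mean zero. -/
theorem integral_flow_eq (hf : IsGradientFlow (cheegerEnergy m) f₀ f) {t : ℝ} (ht : 0 ≤ t) :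
    ∫ x, f t x ∂m = ∫ x, f₀ x ∂m := by
  have hint : ∀ g : Lp ℝ 2 m, inner ℝ (Lp.const 2 m 1) g = ∫ x, g x ∂m := by
    intro g
    rw [L2_inner_eq]
    refine integral_congr_ae ?_
    filter_upwards [Lp.coeFn_const 2 m (1 : ℝ)] with x hx
    rw [hx, Function.const_apply, one_mul]
  rw [← hint, ← hint, ← hf.initial]
  refine inner_eq_of_ae_inner_deriv_eq_zero hf.continuousOn hf.locallyLipschitz ?_ ht
  filter_upwards [hf.deriv_mem] with s ⟨u', hu', hmem⟩
  refine ⟨u', hu', ?_⟩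
  have hG := (isMinimalRelaxedSlope_minimalRelaxedSlope
    (exists_isRelaxedSlope_of_mem_subdifferential hmem)).1
  have key : ∀ a : ℝ, inner ℝ (-u') (Lp.const 2 m a) ≤ 0 := by
    intro a
    have := add_inner_le_of_mem_subdifferential hmem
      (hG.add_smul (isRelaxedSlope_const a) zero_le_one zero_le_one)
    rw [one_smul, one_smul, one_smul, one_smul, add_zero, add_sub_cancel_left] at this
    linarith
  have h1 := key 1
  have h2 := key (-1)
  rw [map_neg] at h2
  simp only [inner_neg_left, inner_neg_right] at h1 h2
  rw [real_inner_comm]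
  linarith

theorem isProbabilityMeasure_densityMeasure {g : Lp ℝ 2 m} (hg : ∀ᵐ x ∂m, 0 ≤ g x)
    (hmass : ∫ x, g x ∂m = 1) : IsProbabilityMeasure (densityMeasure m g) := by
  refine ⟨?_⟩
  rw [densityMeasure, withDensity_apply _ MeasurableSet.univ, setLIntegral_univ,
    ← ofReal_integral_eq_lintegral_ofReal ((Lp.memLp g).integrable (by norm_num)) hg, hmass,
    ENNReal.ofReal_one]

theorem integral_densityMeasure {g : Lp ℝ 2 m} (hg : ∀ᵐ x ∂m, 0 ≤ g x) (φ : C(X, ℝ)) :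
    ∫ x, φ x ∂(densityMeasure m g) = inner ℝ (φ.toLp 2 m ℝ) g := by
  rw [densityMeasure, integral_withDensity_eq_integral_toReal_smul
    (Lp.stronglyMeasurable g).measurable.ennreal_ofReal (by simp), L2_inner_eq]
  refine integral_congr_ae ?_
  filter_upwards [hg, ContinuousMap.coeFn_toLp (p := 2) (𝕜 := ℝ) m φ] with x h1 h2
  rw [h2, ENNReal.toReal_ofReal h1, smul_eq_mul, mul_comm]

/-! ### The Fisher information -/

/-- The integral `∫ G² / g`; for the minimal relaxed slope `G` of `g` it is the Fisher
information of `g`. -/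
noncomputable def slopeInformation (g G : Lp ℝ 2 m) : ℝ := ∫ x, G x ^ 2 / g x ∂m

theorem aestronglyMeasurable_sq_div (g G : Lp ℝ 2 m) :
    AEStronglyMeasurable (fun x => G x ^ 2 / g x) m :=
  (((Lp.stronglyMeasurable G).measurable.pow_const 2).div
    (Lp.stronglyMeasurable g).measurable).aestronglyMeasurable

theorem integrable_sq_div {g : Lp ℝ 2 m} {c : ℝ} (hc : 0 < c) (hg : ∀ᵐ x ∂m, c ≤ g x)
    (G : Lp ℝ 2 m) : Integrable (fun x => G x ^ 2 / g x) m := by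
  refine ((Lp.memLp G).integrable_sq.div_const c).mono' (aestronglyMeasurable_sq_div g G) ?_
  filter_upwards [hg] with x hx
  have := hc.trans_le hx
  rw [Real.norm_eq_abs, abs_of_nonneg (by positivity)]
  gcongr

theorem slopeInformation_nonneg {g : Lp ℝ 2 m} {c : ℝ} (hc : 0 < c) (hg : ∀ᵐ x ∂m, c ≤ g x)
    (G : Lp ℝ 2 m) : 0 ≤ slopeInformation g G := by
  refine integral_nonneg_of_ae ?_
  filter_upwards [hg] with x hx
  have := hc.trans_le hx
  simp only [Pi.zero_apply]
  positivity

theorem slopeInformation_le {g : Lp ℝ 2 m} {c : ℝ} (hc : 0 < c) (hg : ∀ᵐ x ∂m, c ≤ g x)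
    (G : Lp ℝ 2 m) : slopeInformation g G ≤ ‖G‖ ^ 2 / c := by
  rw [L2_norm_sq_eq, ← integral_div]
  refine integral_mono_ae (integrable_sq_div hc hg G) ((Lp.memLp G).integrable_sq.div_const c) ?_
  filter_upwards [hg] with x hx
  gcongr

theorem abs_slopeInformation_sub_le {g : Lp ℝ 2 m} {c : ℝ} (hc : 0 < c) (hg : ∀ᵐ x ∂m, c ≤ g x)
    (F G : Lp ℝ 2 m) :
    |slopeInformation g F - slopeInformation g G| ≤ ‖F - G‖ * ‖F + G‖ / c := by
  rw [slopeInformation, slopeInformation,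
    ← integral_sub (integrable_sq_div hc hg F) (integrable_sq_div hc hg G)]
  have h1 : ∫ x, |F - G| x * |F + G| x / c ∂m ≤ ‖F - G‖ * ‖F + G‖ / c := by
    rw [integral_div, ← L2_inner_eq, ← norm_abs_eq_norm (F - G), ← norm_abs_eq_norm (F + G)]
    gcongr
    exact real_inner_le_norm _ _
  refine le_trans ?_ h1
  rw [← Real.norm_eq_abs]
  refine norm_integral_le_of_norm_le ((L2_integrable_mul _ _).div_const c) ?_
  filter_upwards [hg, Lp.coeFn_abs (F - G), Lp.coeFn_abs (F + G), Lp.coeFn_sub F G,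
    Lp.coeFn_add F G] with x h1 h2 h3 h4 h5
  have := hc.trans_le h1
  rw [h2, h3, h4, h5, Pi.sub_apply, Pi.add_apply, Real.norm_eq_abs, ← sub_div, abs_div,
    abs_of_pos this, ← abs_mul]
  have e : F x ^ 2 - G x ^ 2 = (F x - G x) * (F x + G x) := by ring
  rw [e]
  gcongr

/-- The information depends continuously on both arguments, for densities bounded from below. -/
theorem continuousOn_slopeInformation {c : ℝ} (hc : 0 < c) :
    ContinuousOn (fun p : Lp ℝ 2 m × Lp ℝ 2 m => slopeInformation p.1 p.2)
      {p | ∀ᵐ x ∂m, c ≤ p.1 x} := by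
  rintro ⟨g, G⟩ hg
  refine tendsto_of_subseq_tendsto fun p hp => ?_
  obtain ⟨hp1, hp2⟩ := tendsto_nhdsWithin_iff.1 hp
  have hlim1 : Tendsto (fun n => (p n).1) atTop (𝓝 g) := (continuous_fst.tendsto _).comp hp1
  have hlim2 : Tendsto (fun n => (p n).2) atTop (𝓝 G) := (continuous_snd.tendsto _).comp hp1
  obtain ⟨σ, hσ, hae⟩ := (tendstoInMeasure_of_tendsto_Lp hlim1).exists_seq_tendsto_ae
  obtain ⟨N, hN⟩ := eventually_atTop.1 hp2
  let ρ : ℕ → ℕ := fun n => σ (n + N)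
  have hρN : ∀ n, N ≤ ρ n := fun n => (Nat.le_add_left N n).trans hσ.le_apply
  have hρ : Tendsto ρ atTop atTop := hσ.tendsto_atTop.comp (tendsto_add_atTop_nat N)
  have hmem : ∀ n, ∀ᵐ x ∂m, c ≤ (p (ρ n)).1 x := fun n => hN _ (hρN n)
  refine ⟨ρ, ?_⟩
  have h1 : Tendsto (fun n => slopeInformation (p (ρ n)).1 (p (ρ n)).2 -
      slopeInformation (p (ρ n)).1 G) atTop (𝓝 0) := by
    refine squeeze_zero_norm (fun n => abs_slopeInformation_sub_le hc (hmem n) _ _) ?_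
    have h2 := hlim2.comp hρ
    have h3 := ((h2.sub_const G).norm.mul (h2.add_const G).norm).div_const c
    simpa using h3
  have h2 : Tendsto (fun n => slopeInformation (p (ρ n)).1 G) atTop
      (𝓝 (slopeInformation g G)) := by
    refine tendsto_integral_of_dominated_convergence (fun x => G x ^ 2 / c)
      (fun n => aestronglyMeasurable_sq_div _ _) ((Lp.memLp G).integrable_sq.div_const c)
      (fun n => ?_) ?_
    · filter_upwards [hmem n] with x hx
      have := hc.trans_le hx
      rw [Real.norm_eq_abs, abs_of_nonneg (by positivity)]
      gcongr
    · filter_upwards [hae, hg] with x hx hgx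
      exact tendsto_const_nhds.div (hx.comp (tendsto_add_atTop_nat N)) (hc.trans_le hgx).ne'
  simpa using h1.add h2

/-! ### Regularity of the slope along the flow -/

theorem continuousOn_minimalRelaxedSlope_flow (hf : IsGradientFlow (cheegerEnergy m) f₀ f) :
    ContinuousOn (fun t => minimalRelaxedSlope m (f t)) (regularTimes m f) := by
  rintro t ⟨ht, f't, hf't, hξt⟩
  obtain ⟨K, hK⟩ := exists_lipschitzOnWith_Icc hf.locallyLipschitz (half_pos ht) (b := t + 1)
  have htI : t ∈ Ioo (t / 2) (t + 1) := ⟨by linarith, by linarith⟩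
  have hlim : Tendsto (fun s => 4 * (K + K) * ‖f s - f t‖) (𝓝[regularTimes m f] t) (𝓝 0) := by
    have h1 : ContinuousAt f t := hf't.continuousAt
    have h2 : Tendsto (fun s => 4 * (K + K : ℝ) * ‖f s - f t‖) (𝓝 t)
        (𝓝 (4 * (K + K) * ‖f t - f t‖)) := (h1.sub_const (f t)).norm.const_mul _
    simpa using h2.mono_left nhdsWithin_le_nhds
  rw [ContinuousWithinAt, tendsto_iff_norm_sub_tendsto_zero]
  have hsq : Tendsto (fun s => ‖minimalRelaxedSlope m (f s) - minimalRelaxedSlope m (f t)‖ ^ 2)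
      (𝓝[regularTimes m f] t) (𝓝 0) := by
    refine squeeze_zero' (Eventually.of_forall fun s => sq_nonneg _) ?_ hlim
    filter_upwards [self_mem_nhdsWithin, nhdsWithin_le_nhds (Ioo_mem_nhds htI.1 htI.2)]
      with s ⟨hs, f's, hf's, hξs⟩ hsI
    refine (norm_minimalRelaxedSlope_sub_sq_le hξs hξt).trans ?_
    rw [norm_neg, norm_neg]
    have h1 := norm_hasDerivAt_le hK hsI hf's
    have h2 := norm_hasDerivAt_le hK htI hf't
    gcongr
  simpa using hsq.sqrt

/-- The energy at a regular time is bounded by the dissipation of the squared norm. -/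
theorem norm_minimalRelaxedSlope_sq_le {g ξ : Lp ℝ 2 m}
    (h : ξ ∈ subdifferential (cheegerEnergy m) g) :
    ‖minimalRelaxedSlope m g‖ ^ 2 ≤ 2 * inner ℝ ξ g := by
  have h1 := add_inner_le_of_mem_subdifferential h (isRelaxedSlope_const 0)
  rw [map_zero, zero_sub, inner_neg_right, norm_zero] at h1
  linarith

/-- A curve that is continuous on the set of regular times is measurable: that set contains a
Borel set of full measure. -/
theorem aestronglyMeasurable_of_continuousOn_regularTimes {E : Type*} [TopologicalSpace E]
    [TopologicalSpace.PseudoMetrizableSpace E]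
    (hf : IsGradientFlow (cheegerEnergy m) f₀ f) {v : ℝ → E}
    (hv : ContinuousOn v (regularTimes m f)) :
    AEStronglyMeasurable v (volume.restrict (Ioi 0)) := by
  obtain ⟨D, hD, hDm, hDsub⟩ := (ae_mem_regularTimes hf).exists_measurable_mem
  rw [← Measure.restrict_eq_self_of_ae_mem hD, Measure.restrict_restrict hDm]
  refine (ContinuousOn.aestronglyMeasurable (μ := volume) (hv.mono hDsub) hDm).mono_measure ?_
  exact Measure.restrict_mono inter_subset_left le_rfl

/-- The slopes are bounded, locally in time. -/
theorem exists_norm_minimalRelaxedSlope_sq_le (hf : IsGradientFlow (cheegerEnergy m) f₀ f)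
    {a b : ℝ} (ha : 0 < a) : ∃ B, 0 ≤ B ∧ ∀ t ∈ regularTimes m f ∩ Ioo a b,
      ‖minimalRelaxedSlope m (f t)‖ ^ 2 ≤ B := by
  obtain ⟨K, hK⟩ := exists_lipschitzOnWith_Icc hf.locallyLipschitz ha (b := b)
  obtain ⟨M, hM⟩ := isCompact_Icc.exists_bound_of_continuousOn hK.continuousOn
  refine ⟨2 * (K * |M|), by positivity, ?_⟩
  rintro t ⟨⟨ht, f', hf', hξ⟩, htI⟩
  refine (norm_minimalRelaxedSlope_sq_le hξ).trans ?_
  have h1 := real_inner_le_norm (-f') (f t)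
  rw [norm_neg] at h1
  have h2 := norm_hasDerivAt_le hK htI hf'
  have h3 := (hM t (Ioo_subset_Icc_self htI)).trans (le_abs_self M)
  have h4 : ‖f'‖ * ‖f t‖ ≤ K * |M| := by gcongr
  linarith

theorem ae_mem_Ioo_regularTimes (hf : IsGradientFlow (cheegerEnergy m) f₀ f) {a b : ℝ}
    (ha : 0 ≤ a) : ∀ᵐ t, t ∈ Ioo a b → t ∈ regularTimes m f := by
  filter_upwards [(ae_restrict_iff' measurableSet_Ioi).1 (ae_mem_regularTimes hf)] with t ht htI
  exact ht (ha.trans_lt htI.1)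

theorem aestronglyMeasurable_norm_sq_flow (hf : IsGradientFlow (cheegerEnergy m) f₀ f) :
    AEStronglyMeasurable (fun t => ‖minimalRelaxedSlope m (f t)‖ ^ 2) (volume.restrict (Ioi 0)) :=
  aestronglyMeasurable_of_continuousOn_regularTimes hf
    ((continuousOn_minimalRelaxedSlope_flow hf).norm.pow 2)

theorem intervalIntegrable_norm_sq_flow (hf : IsGradientFlow (cheegerEnergy m) f₀ f) {a b : ℝ}
    (ha : 0 < a) (hab : a ≤ b) :
    IntervalIntegrable (fun t => ‖minimalRelaxedSlope m (f t)‖ ^ 2) volume a b := by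
  obtain ⟨B, -, hB⟩ := exists_norm_minimalRelaxedSlope_sq_le hf ha (b := b)
  rw [intervalIntegrable_iff_integrableOn_Ioo_of_le hab]
  refine Integrable.mono' (g := fun _ => B) (integrableOn_const (by simp))
    ((aestronglyMeasurable_norm_sq_flow hf).mono_measure
      (Measure.restrict_mono (fun t ht => ha.trans ht.1 : Ioo a b ⊆ Ioi 0) le_rfl)) ?_
  refine (ae_restrict_iff' measurableSet_Ioo).2 ?_
  filter_upwards [ae_mem_Ioo_regularTimes hf ha.le] with t ht htI
  rw [Real.norm_eq_abs, abs_of_nonneg (sq_nonneg _)]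
  exact hB t ⟨ht htI, htI⟩

/-- The energy dissipation estimate `∫ |Df_t|_*² dt ≤ ‖f_a‖²`. -/
theorem integral_norm_sq_flow_le (hf : IsGradientFlow (cheegerEnergy m) f₀ f) {a b : ℝ}
    (ha : 0 < a) (hab : a ≤ b) :
    ∫ t in a..b, ‖minimalRelaxedSlope m (f t)‖ ^ 2 ≤ ‖f a‖ ^ 2 := by
  obtain ⟨K, hK⟩ := exists_lipschitzOnWith_Icc hf.locallyLipschitz ha (b := b)
  obtain ⟨L, hL⟩ := exists_lipschitzOnWith_inner hK hK
  simp only [real_inner_self_eq_norm_sq] at hL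
  have := sub_le_integral_of_ae_deriv_le hab hL
    (intervalIntegrable_norm_sq_flow hf ha hab).neg ?_
  · simp only [Pi.neg_apply, intervalIntegral.integral_neg] at this
    linarith [sq_nonneg ‖f b‖]
  filter_upwards [ae_mem_Ioo_regularTimes hf ha.le] with t ht htI φ' hφ'
  obtain ⟨-, f', hf', hξ⟩ := ht htI
  rw [hφ'.unique hf'.norm_sq, Pi.neg_apply]
  have := norm_minimalRelaxedSlope_sq_le hξ
  rw [inner_neg_left, real_inner_comm] at this
  linarith

theorem integrableOn_norm_sq_flow (hf : IsGradientFlow (cheegerEnergy m) f₀ f) (T : ℝ) :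
    IntegrableOn (fun t => ‖minimalRelaxedSlope m (f t)‖ ^ 2) (Ioc 0 T) := by
  rcases le_or_gt T 0 with hT | hT
  · simp [Ioc_eq_empty hT.not_gt]
  obtain ⟨M, hM⟩ := isCompact_Icc.exists_bound_of_continuousOn
    (hf.continuousOn.mono (Icc_subset_Ici_self : Icc 0 T ⊆ Ici 0))
  have hseq : Tendsto (fun n : ℕ => T / ((n : ℝ) + 1)) atTop (𝓝 0) :=
    tendsto_const_nhds.div_atTop (tendsto_atTop_add_const_right _ _ tendsto_natCast_atTop_atTop)
  have hpos : ∀ n : ℕ, 0 < T / ((n : ℝ) + 1) := fun n => by positivity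
  have hle : ∀ n : ℕ, T / ((n : ℝ) + 1) ≤ T := fun n => by
    rw [div_le_iff₀ (by positivity)]
    nlinarith [Nat.cast_nonneg (α := ℝ) n]
  refine integrableOn_Ioc_of_intervalIntegral_norm_bounded_left (l := atTop)
    (a := fun n : ℕ => T / ((n : ℝ) + 1)) (I := M ^ 2) (fun n => ?_) hseq ?_
  · exact (intervalIntegrable_iff_integrableOn_Ioc_of_le (hle n)).1
      (intervalIntegrable_norm_sq_flow hf (hpos n) (hle n))
  · refine Eventually.of_forall fun n => ?_
    rw [← intervalIntegral.integral_of_le (hle n)]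
    simp only [norm_pow, norm_norm]
    refine (integral_norm_sq_flow_le hf (hpos n) (hle n)).trans ?_
    exact pow_le_pow_left₀ (norm_nonneg _) (hM _ ⟨(hpos n).le, hle n⟩) 2

/-- The Fisher information is integrable in time, up to time `0`. -/
theorem integrableOn_slopeInformation_flow (hf : IsGradientFlow (cheegerEnergy m) f₀ f) {c : ℝ}
    (hc : 0 < c) (hf₀ : ∀ᵐ x ∂m, c ≤ f₀ x) (T : ℝ) :
    IntegrableOn (fun t => slopeInformation (f t) (minimalRelaxedSlope m (f t))) (Ioc 0 T) := by
  have hmeas : AEStronglyMeasurable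
      (fun t => slopeInformation (f t) (minimalRelaxedSlope m (f t))) (volume.restrict (Ioi 0)) := by
    refine aestronglyMeasurable_of_continuousOn_regularTimes hf ?_
    refine (continuousOn_slopeInformation hc).comp (f := fun t => (f t, minimalRelaxedSlope m (f t)))
      (ContinuousOn.prodMk (hf.continuousOn.mono fun t ht => ht.1.le)
        (continuousOn_minimalRelaxedSlope_flow hf)) fun t ht => ?_
    exact ae_const_le_flow hf hf₀ ht.1.le
  refine ((integrableOn_norm_sq_flow hf T).div_const c).mono'
    (hmeas.mono_measure (Measure.restrict_mono Ioc_subset_Ioi_self le_rfl)) ?_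
  refine (ae_restrict_iff' measurableSet_Ioc).2 (ae_of_all _ fun t ht => ?_)
  have hct := ae_const_le_flow hf hf₀ ht.1.le
  rw [Real.norm_eq_abs, abs_of_nonneg (slopeInformation_nonneg hc hct _)]
  exact slopeInformation_le hc hct _

end Flow

/-! ### Kuwada's estimate -/

section Kuwada

variable {X : Type*} [MetricSpace X] [CompactSpace X] [MeasurableSpace X] [BorelSpace X]
  {m : Measure X} [IsProbabilityMeasure m] {f₀ : Lp ℝ 2 m} {f : ℝ → Lp ℝ 2 m}

theorem localSlope_neg (g : X → ℝ) : localSlope (-g) = localSlope g := by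
  ext x
  simp only [localSlope, Pi.neg_apply, edist_neg_neg]

theorem integrable_localSlope_sq_mul {g : X → ℝ} (hg : ∃ K, LipschitzWith K g) (u : Lp ℝ 2 m) :
    Integrable (fun x => (localSlope g x).toReal ^ 2 * u x) m := by
  obtain ⟨K, hK⟩ := hg
  refine ((Lp.memLp u).integrable (by norm_num)).bdd_mul (c := (K : ℝ) ^ 2)
    (((measurable_localSlope hK.continuous).ennreal_toReal.pow_const 2).aestronglyMeasurable)
    (ae_of_all _ fun x => ?_)
  rw [Real.norm_eq_abs, abs_of_nonneg (sq_nonneg _)]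
  exact pow_le_pow_left₀ ENNReal.toReal_nonneg
    (ENNReal.toReal_mono ENNReal.coe_ne_top (localSlope_le_of_lipschitzWith hK x)) 2

/-- Young's inequality with weight `u`. -/
theorem inner_localSlope_le {g : X → ℝ} (hg : ∃ K, LipschitzWith K g) {u : Lp ℝ 2 m} {c h : ℝ}
    (hc : 0 < c) (hh : 0 < h) (hu : ∀ᵐ x ∂m, c ≤ u x) (G : Lp ℝ 2 m) :
    inner ℝ G ((memLp_localSlope m hg).toLp _) ≤
      1 / (2 * h) * ∫ x, (localSlope g x).toReal ^ 2 * u x ∂m + h / 2 * slopeInformation u G := by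
  rw [L2_inner_toLp, slopeInformation, ← integral_const_mul, ← integral_const_mul,
    ← integral_add ((integrable_localSlope_sq_mul hg u).const_mul _)
      ((integrable_sq_div hc hu G).const_mul _)]
  refine integral_mono_ae ((Lp.memLp G).integrable_mul (memLp_localSlope m hg))
    (((integrable_localSlope_sq_mul hg u).const_mul _).add
      ((integrable_sq_div hc hu G).const_mul _)) ?_
  filter_upwards [hu] with x hx
  have hpos : 0 < u x := hc.trans_le hx
  set S := (localSlope g x).toReal
  have e : 1 / (2 * h) * (S ^ 2 * u x) + h / 2 * (G x ^ 2 / u x) - G x * S =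
      (S * u x - h * G x) ^ 2 / (2 * h * u x) := by
    field_simp; ring
  have : 0 ≤ (S * u x - h * G x) ^ 2 / (2 * h * u x) := by positivity
  linarith

theorem inner_toLp_mono {φ ψ : C(X, ℝ)} (h : ∀ x, φ x ≤ ψ x) {u : Lp ℝ 2 m}
    (hu : ∀ᵐ x ∂m, 0 ≤ u x) :
    inner ℝ (φ.toLp 2 m ℝ) u ≤ inner ℝ (ψ.toLp 2 m ℝ) u := by
  rw [L2_inner_eq, L2_inner_eq]
  refine integral_mono_ae (L2_integrable_mul _ _) (L2_integrable_mul _ _) ?_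
  filter_upwards [hu, ContinuousMap.coeFn_toLp (p := 2) (𝕜 := ℝ) m φ,
    ContinuousMap.coeFn_toLp (p := 2) (𝕜 := ℝ) m ψ] with x h1 h2 h3
  rw [h2, h3]
  exact mul_le_mul_of_nonneg_right (h x) h1

/-- Along the flow, the integral of the Hopf-Lax evolution of a potential grows at most at a rate
given by the Fisher information: the Hamilton-Jacobi inequality for the potential, the integration
by parts inequality for the density, and Young's inequality. -/
theorem deriv_inner_hopfLax_le {χ : C(X, ℝ)} {c h t₀ t F' : ℝ} (hc : 0 < c) (hh : 0 < h)
    (ht₀ : t₀ < t) (hct : ∀ᵐ x ∂m, c ≤ f t x) (ht : t ∈ regularTimes m f)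
    (hcont : Tendsto (fun s => (hopfLax χ ((s - t₀) / h)).toLp 2 m ℝ) (𝓝 t)
      (𝓝 ((hopfLax χ ((t - t₀) / h)).toLp 2 m ℝ)))
    (hF : HasDerivAt (fun s => inner ℝ ((hopfLax χ ((s - t₀) / h)).toLp 2 m ℝ) (f s)) F' t) :
    F' ≤ h / 2 * slopeInformation (f t) (minimalRelaxedSlope m (f t)) := by
  obtain ⟨-, f', hf', hξ⟩ := ht
  have : Nonempty X := m.nonempty_of_neZero
  set q : ℝ → Lp ℝ 2 m := fun s => (hopfLax χ ((s - t₀) / h)).toLp 2 m ℝ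
  set r := (t - t₀) / h with hr
  have hr0 : 0 < r := div_pos (sub_pos.2 ht₀) hh
  have hQ := lipschitzWith_hopfLax χ hr0
  set J := ∫ x, (localSlope (hopfLax χ r) x).toReal ^ 2 * f t x ∂m with hJ
  have hstep : ∀ δ, 0 < δ → inner ℝ (q (t + δ) - q t) (f t) ≤
      -(δ / h * r / (r + δ / h)) * (1 / 2) * J := by
    intro δ hδ
    have e : (t + δ - t₀) / h = r + δ / h := by rw [hr]; ring
    rw [L2_inner_eq, hJ, ← integral_const_mul]
    refine integral_mono_ae (L2_integrable_mul _ _)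
      ((integrable_localSlope_sq_mul hQ (f t)).const_mul _) ?_
    filter_upwards [hct, Lp.coeFn_sub (q (t + δ)) (q t),
      ContinuousMap.coeFn_toLp (p := 2) (𝕜 := ℝ) m (hopfLax χ ((t + δ - t₀) / h)),
      ContinuousMap.coeFn_toLp (p := 2) (𝕜 := ℝ) m (hopfLax χ r)] with x h1 h2 h3 h4
    simp only [q] at h2 ⊢
    rw [h2, Pi.sub_apply, h3, h4, e]
    have h5 := hopfLax_add_sub_le χ hr0 (div_pos hδ hh) x
    have h6 := mul_le_mul_of_nonneg_right h5 (hc.le.trans h1)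
    linarith
  have hslope : Tendsto (fun δ : ℝ => δ⁻¹ * (inner ℝ (q (t + δ)) (f (t + δ)) -
      inner ℝ (q t) (f t))) (𝓝[>] 0) (𝓝 F') := by
    have := hF.tendsto_slope_zero_right
    simpa using this
  have hslope' : Tendsto (fun δ : ℝ => δ⁻¹ • (f (t + δ) - f t)) (𝓝[>] 0) (𝓝 f') :=
    hf'.tendsto_slope_zero_right
  have hshift : Tendsto (fun δ : ℝ => t + δ) (𝓝[>] 0) (𝓝 t) := by
    have : Continuous fun δ : ℝ => t + δ := by fun_prop
    simpa using (this.tendsto 0).mono_left (nhdsWithin_le_nhds (s := Ioi 0))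
  have hlim : Tendsto (fun δ : ℝ => -(1 / h * (r / (r + δ / h))) * (1 / 2) * J +
      inner ℝ (q (t + δ)) (δ⁻¹ • (f (t + δ) - f t))) (𝓝[>] 0)
      (𝓝 (-(1 / h * (r / (r + 0 / h))) * (1 / 2) * J + inner ℝ (q t) f')) := by
    refine Tendsto.add ?_ ((hcont.comp hshift).inner hslope')
    have h0 : r + 0 / h ≠ 0 := by simpa using hr0.ne'
    have : ContinuousAt (fun δ : ℝ => -(1 / h * (r / (r + δ / h))) * (1 / 2) * J) 0 := by
      fun_prop (disch := assumption)
    exact this.tendsto.mono_left nhdsWithin_le_nhds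
  have h1 : F' ≤ -(1 / h * (r / (r + 0 / h))) * (1 / 2) * J + inner ℝ (q t) f' := by
    refine le_of_tendsto_of_tendsto hslope hlim ?_
    filter_upwards [self_mem_nhdsWithin] with δ hδ
    have hδ : 0 < δ := hδ
    have e1 : inner ℝ (q (t + δ)) (f (t + δ)) - inner ℝ (q t) (f t) =
        inner ℝ (q (t + δ) - q t) (f t) + inner ℝ (q (t + δ)) (f (t + δ) - f t) := by
      rw [inner_sub_left, inner_sub_right]; ring
    have h2 := mul_le_mul_of_nonneg_left (hstep δ hδ) (inv_nonneg.2 hδ.le)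
    rw [e1, mul_add, inner_smul_right]
    refine add_le_add (h2.trans_eq ?_) le_rfl
    field_simp
  have hQ' : ∃ K, LipschitzWith K (-(hopfLax χ r : X → ℝ)) := by
    obtain ⟨K, hK⟩ := hQ
    exact ⟨K, hK.neg⟩
  -- the subgradient is `-f'`, so that the integration by parts is applied to `-hopfLax χ r`
  have h2 := inner_le_inner_localSlope hξ hQ'
  have h3 := inner_localSlope_le hQ' hc hh hct (minimalRelaxedSlope m (f t))
  have e2 : (memLp_lipschitz m hQ').toLp _ = -q t := by
    refine Lp.ext ?_
    filter_upwards [(memLp_lipschitz m hQ').coeFn_toLp, Lp.coeFn_neg (q t),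
      ContinuousMap.coeFn_toLp (p := 2) (𝕜 := ℝ) m (hopfLax χ r)] with x h4 h5 h6
    rw [h4, h5, Pi.neg_apply, Pi.neg_apply, h6]
  rw [e2, inner_neg_neg, real_inner_comm] at h2
  have hJ' : ∫ x, (localSlope (-(hopfLax χ r : X → ℝ)) x).toReal ^ 2 * f t x ∂m = J := by
    rw [localSlope_neg]
  rw [hJ'] at h3
  have e3 : -(1 / h * (r / (r + 0 / h))) * (1 / 2) * J = -(1 / (2 * h) * J) := by
    rw [zero_div, add_zero, div_self hr0.ne']; field_simp
  rw [e3] at h1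
  linarith

theorem intervalIntegrable_slopeInformation_flow (hf : IsGradientFlow (cheegerEnergy m) f₀ f)
    {c : ℝ} (hc : 0 < c) (hf₀ : ∀ᵐ x ∂m, c ≤ f₀ x) {a b : ℝ} (ha : 0 ≤ a) (hab : a ≤ b) :
    IntervalIntegrable (fun t => slopeInformation (f t) (minimalRelaxedSlope m (f t)))
      volume a b :=
  (intervalIntegrable_iff_integrableOn_Ioc_of_le hab).2
    ((integrableOn_slopeInformation_flow hf hc hf₀ b).mono_set (Ioc_subset_Ioc_left ha))

/-- The dual form of the estimate of the Wasserstein distance along the flow. -/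
theorem inner_add_inner_le (hf : IsGradientFlow (cheegerEnergy m) f₀ f) {c : ℝ} (hc : 0 < c)
    (hf₀ : ∀ᵐ x ∂m, c ≤ f₀ x) {t s : ℝ} (ht : 0 ≤ t) (hts : t < s) {φ ψ : C(X, ℝ)}
    (h : ∀ x y, φ x + ψ y ≤ 1 / 2 * dist x y ^ 2) :
    inner ℝ (φ.toLp 2 m ℝ) (f t) + inner ℝ (ψ.toLp 2 m ℝ) (f s) ≤
      1 / 2 * ((s - t) * ∫ r in t..s, slopeInformation (f r) (minimalRelaxedSlope m (f r))) := by
  have : Nonempty X := m.nonempty_of_neZero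
  set A : ℝ → ℝ := fun r => slopeInformation (f r) (minimalRelaxedSlope m (f r)) with hA
  have hst : 0 < s - t := sub_pos.2 hts
  have hlow : ∀ r, 0 ≤ r → ∀ᵐ x ∂m, c ≤ f r x := fun r hr => ae_const_le_flow hf hf₀ hr
  have hnn : ∀ r, 0 ≤ r → ∀ᵐ x ∂m, 0 ≤ f r x := fun r hr =>
    (hlow r hr).mono fun x hx => hc.le.trans hx
  let q : ℝ → Lp ℝ 2 m := fun τ => (hopfLax (-φ) ((τ - t) / (s - t))).toLp 2 m ℝ
  have hAint : IntervalIntegrable A volume t s :=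
    intervalIntegrable_slopeInformation_flow hf hc hf₀ ht hts.le
  -- the estimate from an intermediate time `a` on, where the Hopf-Lax evolution is Lipschitz
  have key : ∀ a ∈ Ioo t s, inner ℝ (φ.toLp 2 m ℝ) (f a) + inner ℝ (ψ.toLp 2 m ℝ) (f s) ≤
      (s - t) / 2 * ∫ r in t..s, A r := by
    intro a ha
    have ha0 : 0 < a := ht.trans_lt ha.1
    obtain ⟨K, hK⟩ := exists_lipschitzOnWith_Icc hf.locallyLipschitz ha0 (b := s)
    have hε : 0 < (a - t) / (s - t) := div_pos (sub_pos.2 ha.1) hst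
    obtain ⟨L, hL⟩ : ∃ L, LipschitzOnWith L q (Icc a s) := by
      set D := Metric.diam (univ : Set X) ^ 2 / (2 * ((a - t) / (s - t)) ^ 2) * (1 / (s - t))
      have hD : 0 ≤ D := by positivity
      have : LipschitzOnWith D.toNNReal (fun τ => hopfLax (-φ) ((τ - t) / (s - t))) (Icc a s) := by
        refine LipschitzOnWith.of_dist_le_mul fun τ hτ τ' hτ' => ?_
        rw [dist_eq_norm, Real.coe_toNNReal _ hD]
        refine (norm_hopfLax_sub_le (-φ) hε ?_ ?_).trans_eq ?_
        · gcongr; exact hτ.1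
        · gcongr; exact hτ'.1
        · rw [← sub_div, sub_sub_sub_cancel_right, abs_div, abs_of_pos hst, Real.dist_eq]
          simp only [D]; ring
      exact ⟨_, (ContinuousMap.toLp (E := ℝ) 2 m ℝ).lipschitz.comp_lipschitzOnWith this⟩
    obtain ⟨M, hM⟩ := exists_lipschitzOnWith_inner hL hK
    have hint := (hAint.mono_set (by
      rw [uIcc_of_le ha.2.le, uIcc_of_le hts.le]; exact Icc_subset_Icc_left ha.1.le :
      uIcc a s ⊆ uIcc t s)).const_mul ((s - t) / 2)
    have h1 := sub_le_integral_of_ae_deriv_le ha.2.le hM hint ?_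
    · rw [intervalIntegral.integral_const_mul] at h1
      have h2 : inner ℝ (q a) (f a) ≤ -inner ℝ (φ.toLp 2 m ℝ) (f a) := by
        rw [← inner_neg_left, ← map_neg]
        exact inner_toLp_mono (fun x => hopfLax_le_self (-φ) _ x) (hnn a ha0.le)
      have h3 : inner ℝ (ψ.toLp 2 m ℝ) (f s) ≤ inner ℝ (q s) (f s) := by
        refine inner_toLp_mono (fun y => ?_) (hnn s (ht.trans hts.le))
        rw [div_self hst.ne']
        obtain ⟨x, hx⟩ := exists_hopfLax_eq (-φ) 1 y
        have := h x y
        rw [hx, ContinuousMap.neg_apply, dist_comm]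
        linarith
      have h4 : ∫ r in a..s, A r ≤ ∫ r in t..s, A r := by
        refine intervalIntegral.integral_mono_interval ha.1.le ha.2.le le_rfl ?_ hAint
        refine (ae_restrict_iff' measurableSet_Ioc).2 (ae_of_all _ fun r hr => ?_)
        exact slopeInformation_nonneg hc (hlow r (ht.trans hr.1.le)) _
      have h5 := mul_le_mul_of_nonneg_left h4 (half_pos hst).le
      linarith
    · filter_upwards [ae_mem_Ioo_regularTimes hf ha0.le] with τ hτ hτI F' hF'
      exact deriv_inner_hopfLax_le hc hst (ha.1.trans hτI.1) (hlow τ (ha0.trans hτI.1).le)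
        (hτ hτI) (hL.continuousOn.continuousAt (Icc_mem_nhds hτI.1 hτI.2)) hF'
  have hlim : Tendsto (fun a => inner ℝ (φ.toLp 2 m ℝ) (f a) + inner ℝ (ψ.toLp 2 m ℝ) (f s))
      (𝓝[>] t) (𝓝 (inner ℝ (φ.toLp 2 m ℝ) (f t) + inner ℝ (ψ.toLp 2 m ℝ) (f s))) := by
    have h1 : Tendsto f (𝓝[>] t) (𝓝 (f t)) :=
      (hf.continuousOn t ht).mono_left
        (nhdsWithin_mono t (fun r hr => ht.trans (le_of_lt hr) : Ioi t ⊆ Ici 0))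
    exact (tendsto_const_nhds.inner h1).add_const _
  have := le_of_tendsto hlim (by filter_upwards [Ioo_mem_nhdsGT hts] with a ha using key a ha)
  linarith

/-- Kuwada's estimate of the Wasserstein distance along the flow. -/
theorem W2_sq_flow_le (hf : IsGradientFlow (cheegerEnergy m) f₀ f) {c : ℝ} (hc : 0 < c)
    (hf₀ : ∀ᵐ x ∂m, c ≤ f₀ x) (hmass : ∫ x, f₀ x ∂m = 1) {t s : ℝ} (ht : 0 ≤ t) (hts : t < s) :
    W2 (densityMeasure m (f s)) (densityMeasure m (f t)) ^ 2 ≤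
      (s - t) * ∫ r in t..s, slopeInformation (f r) (minimalRelaxedSlope m (f r)) := by
  have hnn : ∀ r, 0 ≤ r → ∀ᵐ x ∂m, 0 ≤ f r x := fun r hr =>
    (ae_const_le_flow hf hf₀ hr).mono fun x hx => hc.le.trans hx
  have hprob : ∀ r, 0 ≤ r → IsProbabilityMeasure (densityMeasure m (f r)) := fun r hr =>
    isProbabilityMeasure_densityMeasure (hnn r hr) (by rw [integral_flow_eq hf hr, hmass])
  have hs : 0 ≤ s := ht.trans hts.le
  have := hprob t ht
  have := hprob s hs
  rw [W2_comm]
  refine W2_sq_le _ _ fun φ ψ h => ?_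
  rw [integral_densityMeasure (hnn t ht), integral_densityMeasure (hnn s hs)]
  exact inner_add_inner_le hf hc hf₀ ht hts h

end Kuwada

/-! ### The curve of measures -/

section Curve

variable {X : Type*} [MetricSpace X] [CompactSpace X] [MeasurableSpace X] [BorelSpace X]
  {m : Measure X} [IsProbabilityMeasure m] {f₀ : Lp ℝ 2 m} {f : ℝ → Lp ℝ 2 m}

theorem isProbabilityMeasure_flow (hf : IsGradientFlow (cheegerEnergy m) f₀ f) {c : ℝ}
    (hc : 0 < c) (hf₀ : ∀ᵐ x ∂m, c ≤ f₀ x) (hmass : ∫ x, f₀ x ∂m = 1) {t : ℝ} (ht : 0 ≤ t) :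
    IsProbabilityMeasure (densityMeasure m (f t)) :=
  isProbabilityMeasure_densityMeasure
    ((ae_const_le_flow hf hf₀ ht).mono fun _ hx => hc.le.trans hx)
    (by rw [integral_flow_eq hf ht, hmass])

theorem absolutelyContinuousCurve_flow (hf : IsGradientFlow (cheegerEnergy m) f₀ f) {c : ℝ}
    (hc : 0 < c) (hf₀ : ∀ᵐ x ∂m, c ≤ f₀ x) (hmass : ∫ x, f₀ x ∂m = 1) (T : ℝ) :
    AbsolutelyContinuousCurve W2 (Icc 0 T) (fun t => densityMeasure m (f t)) := by
  set A : ℝ → ℝ := fun r => slopeInformation (f r) (minimalRelaxedSlope m (f r)) with hA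
  refine ⟨fun r => 1 / 2 * (1 + A r), ?_, fun t ht s hs hts => ?_⟩
  · rw [integrableOn_Icc_iff_integrableOn_Ioc]
    exact ((integrableOn_const (by simp)).add
      (integrableOn_slopeInformation_flow hf hc hf₀ T)).const_mul _
  · have hint := intervalIntegrable_slopeInformation_flow hf hc hf₀ ht.1 hts.le
    have h1 := W2_sq_flow_le hf hc hf₀ hmass ht.1 hts
    have h2 : 0 ≤ ∫ r in t..s, A r := by
      refine intervalIntegral.integral_nonneg hts.le fun r hr => ?_
      exact slopeInformation_nonneg hc (ae_const_le_flow hf hf₀ (ht.1.trans hr.1)) _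
    rw [intervalIntegral.integral_const_mul, intervalIntegral.integral_add (by simp) hint]
    simp only [intervalIntegral.integral_const, smul_eq_mul, mul_one]
    have h3 : 0 ≤ s - t := (sub_pos.2 hts).le
    refine (pow_le_pow_iff_left₀ (W2_nonneg _ _) (by positivity) two_ne_zero).1 (h1.trans ?_)
    -- the arithmetic-geometric mean inequality
    nlinarith [sq_nonneg ((s - t) - ∫ r in t..s, A r)]

/-- Away from time `0` the curve is locally Lipschitz, since the slopes are locally bounded. -/
theorem exists_W2_flow_le_mul (hf : IsGradientFlow (cheegerEnergy m) f₀ f) {c : ℝ}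
    (hc : 0 < c) (hf₀ : ∀ᵐ x ∂m, c ≤ f₀ x) (hmass : ∫ x, f₀ x ∂m = 1) {a b : ℝ} (ha : 0 < a) :
    ∃ K, 0 ≤ K ∧ ∀ s ∈ Icc a b, ∀ t ∈ Icc a b,
      W2 (densityMeasure m (f s)) (densityMeasure m (f t)) ≤ K * |s - t| := by
  obtain ⟨B, hB0, hB⟩ := exists_norm_minimalRelaxedSlope_sq_le hf ha (b := b)
  have key : ∀ t ∈ Icc a b, ∀ s ∈ Icc a b, t < s →
      W2 (densityMeasure m (f s)) (densityMeasure m (f t)) ≤ √(B / c) * (s - t) := by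
    intro t ht s hs hts
    have ht0 : 0 ≤ t := ha.le.trans ht.1
    have h1 := W2_sq_flow_le hf hc hf₀ hmass ht0 hts
    have h2 : ∫ r in t..s, slopeInformation (f r) (minimalRelaxedSlope m (f r)) ≤
        ∫ _ in t..s, B / c := by
      refine intervalIntegral.integral_mono_ae_restrict hts.le
        (intervalIntegrable_slopeInformation_flow hf hc hf₀ ht0 hts.le) (by simp) ?_
      rw [← Measure.restrict_congr_set Ioo_ae_eq_Icc]
      refine (ae_restrict_iff' measurableSet_Ioo).2 ?_
      filter_upwards [ae_mem_Ioo_regularTimes hf ha.le (b := b)] with r hr hrI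
      have hrI' : r ∈ Ioo a b := ⟨ht.1.trans_lt hrI.1, hrI.2.trans_le hs.2⟩
      refine (slopeInformation_le hc (ae_const_le_flow hf hf₀ (ha.trans hrI'.1).le) _).trans ?_
      exact div_le_div_of_nonneg_right (hB r ⟨hr hrI', hrI'⟩) hc.le
    simp only [intervalIntegral.integral_const, smul_eq_mul] at h2
    have h3 : 0 ≤ s - t := (sub_pos.2 hts).le
    refine (pow_le_pow_iff_left₀ (W2_nonneg _ _) (by positivity) two_ne_zero).1 (h1.trans ?_)
    rw [mul_pow, Real.sq_sqrt (by positivity)]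
    nlinarith [mul_le_mul_of_nonneg_left h2 h3]
  refine ⟨√(B / c), Real.sqrt_nonneg _, fun s hs t ht => ?_⟩
  rcases lt_trichotomy s t with h | rfl | h
  · rw [W2_comm, abs_sub_comm, abs_of_pos (sub_pos.2 h)]
    exact key s hs t ht h
  · have := isProbabilityMeasure_flow hf hc hf₀ hmass (ha.le.trans hs.1)
    rw [W2_self, sub_self, abs_zero, mul_zero]
  · rw [abs_of_pos (sub_pos.2 h)]
    exact key t ht s hs h

/-- The bound of the metric speed, at the Lebesgue points of the Fisher information. -/
theorem metricSpeed_sq_le (hf : IsGradientFlow (cheegerEnergy m) f₀ f) {c : ℝ}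
    (hc : 0 < c) (hf₀ : ∀ᵐ x ∂m, c ≤ f₀ x) (hmass : ∫ x, f₀ x ∂m = 1) {t v A : ℝ} (ht : 0 < t)
    (hA : HasDerivAt
      (fun s => ∫ r in (0 : ℝ)..s, slopeInformation (f r) (minimalRelaxedSlope m (f r))) A t)
    (hv : HasMetricSpeedAt W2 (fun s => densityMeasure m (f s)) t v) : v ^ 2 ≤ A := by
  have h1 : Tendsto (fun s => (W2 (densityMeasure m (f s)) (densityMeasure m (f t)) /
      |s - t|) ^ 2) (𝓝[>] t) (𝓝 (v ^ 2)) :=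
    (Tendsto.mono_left hv (nhdsWithin_mono t fun s hs => ne_of_gt hs)).pow 2
  have h2 := hA.tendsto_slope.mono_left (nhdsWithin_mono t fun s (hs : t < s) => ne_of_gt hs)
  refine le_of_tendsto_of_tendsto h1 h2 ?_
  filter_upwards [self_mem_nhdsWithin] with s hs
  have hs : t < s := hs
  have hst : 0 < s - t := sub_pos.2 hs
  rw [slope_def_field, intervalIntegral.integral_interval_sub_left
    (intervalIntegrable_slopeInformation_flow hf hc hf₀ le_rfl (ht.trans hs).le)
    (intervalIntegrable_slopeInformation_flow hf hc hf₀ le_rfl ht.le), div_pow, sq_abs,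
    div_le_div_iff₀ (by positivity) hst]
  have h3 := mul_le_mul_of_nonneg_right (W2_sq_flow_le hf hc hf₀ hmass ht.le hs) hst.le
  linarith

theorem ae_exists_metricSpeed_flow (hf : IsGradientFlow (cheegerEnergy m) f₀ f) {c : ℝ}
    (hc : 0 < c) (hf₀ : ∀ᵐ x ∂m, c ≤ f₀ x) (hmass : ∫ x, f₀ x ∂m = 1) :
    ∀ᵐ t ∂(volume.restrict (Ioi (0 : ℝ))), ∃ v : ℝ,
      HasMetricSpeedAt W2 (fun s => densityMeasure m (f s)) t v := by
  have : Nonempty X := m.nonempty_of_neZero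
  refine ae_exists_metricSpeed
    (W := fun s t => W2 (densityMeasure m (f s)) (densityMeasure m (f t)))
    (fun s _ t _ => W2_comm _ _) (fun r hr s hs t ht => ?_)
    (fun a b ha _ => exists_W2_flow_le_mul hf hc hf₀ hmass ha)
  have := isProbabilityMeasure_flow hf hc hf₀ hmass hr.le
  have := isProbabilityMeasure_flow hf hc hf₀ hmass hs.le
  have := isProbabilityMeasure_flow hf hc hf₀ hmass ht.le
  exact W2_triangle _ _ _

theorem ae_hasDerivAt_integral_slopeInformation_flow
    (hf : IsGradientFlow (cheegerEnergy m) f₀ f) {c : ℝ}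
    (hc : 0 < c) (hf₀ : ∀ᵐ x ∂m, c ≤ f₀ x) :
    ∀ᵐ t ∂(volume.restrict (Ioi (0 : ℝ))), HasDerivAt
      (fun s => ∫ r in (0 : ℝ)..s, slopeInformation (f r) (minimalRelaxedSlope m (f r)))
      (slopeInformation (f t) (minimalRelaxedSlope m (f t))) t := by
  have key := ae_all_iff.2 fun n : ℕ => (intervalIntegrable_slopeInformation_flow hf hc hf₀ le_rfl
    n.cast_nonneg).ae_hasDerivAt_integral
  refine (ae_restrict_iff' measurableSet_Ioi).2 ?_
  filter_upwards [key] with t ht ht0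
  obtain ⟨n, hn⟩ := exists_nat_gt t
  refine ht n ?_ 0 left_mem_uIcc
  rw [uIcc_of_le n.cast_nonneg]
  exact ⟨le_of_lt ht0, hn.le⟩

end Curve

end MetricHeat

/-! ### Kuwada's lemma -/

theorem lemma4 {X : Type*} [MetricSpace X] [CompactSpace X] [MeasurableSpace X] [BorelSpace X]
    (m : Measure X) [IsProbabilityMeasure m]
    (f₀ : Lp ℝ 2 m) (f : ℝ → Lp ℝ 2 m)
    (hf : MetricHeat.IsGradientFlow (MetricHeat.cheegerEnergy m) f₀ f)
    (c C : ℝ) (hc : 0 < c) (hbound : ∀ᵐ x ∂m, c ≤ f₀ x ∧ f₀ x ≤ C)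
    (hmass : ∫ x, f₀ x ∂m = 1) :
    -- the curve `t ↦ f_t m` takes its values in the probability measures, with positive densities
    (∀ t : ℝ, 0 ≤ t → (∀ᵐ x ∂m, 0 < f t x) ∧
      IsProbabilityMeasure (MetricHeat.densityMeasure m (f t))) ∧
    -- it is absolutely continuous for the Wasserstein distance, on bounded time intervals
    (∀ T : ℝ, 0 < T → MetricHeat.AbsolutelyContinuousCurve MetricHeat.W2 (Icc 0 T)
      (fun t => MetricHeat.densityMeasure m (f t))) ∧
    -- the bound on its metric speed
    (∀ᵐ t ∂(volume.restrict (Ioi (0 : ℝ))), ∃ v : ℝ,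
      MetricHeat.HasMetricSpeedAt MetricHeat.W2
        (fun s => MetricHeat.densityMeasure m (f s)) t v ∧
      MetricHeat.IsMinimalRelaxedSlope m (f t) (MetricHeat.minimalRelaxedSlope m (f t)) ∧
      Integrable (fun x => (MetricHeat.minimalRelaxedSlope m (f t) x) ^ 2 / f t x) m ∧
      v ^ 2 ≤ ∫ x, (MetricHeat.minimalRelaxedSlope m (f t) x) ^ 2 / f t x ∂m) := by
  have hf₀ : ∀ᵐ x ∂m, c ≤ f₀ x := hbound.mono fun _ hx => hx.1
  refine ⟨fun t ht => ⟨?_, MetricHeat.isProbabilityMeasure_flow hf hc hf₀ hmass ht⟩, fun T _ =>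
    MetricHeat.absolutelyContinuousCurve_flow hf hc hf₀ hmass T, ?_⟩
  · exact (MetricHeat.ae_const_le_flow hf hf₀ ht).mono fun _ hx => hc.trans_le hx
  · filter_upwards [MetricHeat.ae_exists_metricSpeed_flow hf hc hf₀ hmass,
      MetricHeat.ae_hasDerivAt_integral_slopeInformation_flow hf hc hf₀,
      MetricHeat.ae_mem_regularTimes hf] with t ⟨v, hv⟩ hA ⟨ht, _, _, hξ⟩
    exact ⟨v, hv, MetricHeat.isMinimalRelaxedSlope_minimalRelaxedSlope
        (MetricHeat.exists_isRelaxedSlope_of_mem_subdifferential hξ),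
      MetricHeat.integrable_sq_div hc (MetricHeat.ae_const_le_flow hf hf₀ ht.le) _,
      MetricHeat.metricSpeed_sq_le hf hc hf₀ hmass ht hA hv⟩
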